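/- Let $\Lambda$ be an associative ring with identity and let $n$ be a positive integer. Write $\operatorname{mod}\Lambda$ and $\operatorname{mod}\Lambda^{\mathrm{op}}$ for the categories of finitely presented right, respectively left, $\Lambda$-modules, and $\operatorname{proj}\Lambda$ for the category of finitely generated projective right $\Lambda$-modules. Then $\operatorname{proj}\Lambda$ is $n$-abelian if and only if the following conditions hold: (R1) $\Lambda$ is right coherent and $\operatorname{gldim}(\operatorname{mod}\Lambda)\leqslant n+1$; (R1$^{\mathrm{op}}$) $\Lambda$ is left coherent and $\operatorname{gldim}(\operatorname{mod}\Lambda^{\mathrm{op}})\leqslant n+1$; (R2) every $M\in\operatorname{mod}\Lambda$ with $\operatorname{pdim}M\leqslant 1$ is $n$-torsion free; (R2$^{\mathrm{op}}$) every $M\in\operatorname{mod}\Lambda^{\mathrm{op}}$ with $\operatorname{pdim}M\leqslant 1$ is $n$-torsion free. Here $\Lambda$ is right (left) coherent if $\operatorname{mod}\Lambda$ (respectively $\operatorname{mod}\Lambda^{\mathrm{op}}$) is an abelian category, and global dimensions, projective dimensions and $\operatorname{Ext}$ are taken in these abelian categories. If $P\xrightarrow{f}Q\to M\to 0$ is exact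 with $P,Q$ finitely generated projective, the cokernel of $\operatorname{Hom}_\Lambda(f,\Lambda):\operatorname{Hom}_\Lambda(Q,\Lambda)\to\operatorname{Hom}_\Lambda(P,\Lambda)$ is called a transpose $\operatorname{Tr}M$ of $M$ (a module on the other side), and $M$ is $n$-torsion free if $\operatorname{Ext}^i(\operatorname{Tr}M,\Lambda)=0$ for all $1\leqslant i\leqslant n$, which does not depend on the choice of the transpose. In a preadditive category $\mathcal C$, an $n$-kernel of $f:X\to Y$ is a sequence $X_n\to\cdots\to X_1\to X$ such that $0\to\mathcal C(-,X_n)\to\cdots\to\mathcal C(-,X_1)\to\mathcal C(-,X)\to\mathcal C(-,Y)$ is exact (objectwise); $n$-cokernels are defined dually. $\mathcal C$ is $n$-abelian if it is additive and idempotent complete, every morphism has an $n$-kernel and an $n$-cokernel, for every monomorphism $f:X\to Y$ and every $n$-cokernel $Y\xrightarrow{g_1}Y_1\to\cdots\xrightarrow{g_n}Y_n$ of $f$ the sequence $X\xrightarrow{f}Y\xrightarrow{g_1}\cdots\xrightarrow{g_{n-1}}Y_{n-1}$ is an $n$-kernel of $g_n$, and dually for every epimorphism and every $n$-kernel of it.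 -/

import Mathlib

open CategoryTheory CategoryTheory.Limits

universe v u

/-! ### `n`-abelian categories -/

section NAbelian

variable {C : Type u} [Category.{v} C] [Preadditive C]

/-- For a sequence `S₀ ⟶ S₁ ⟶ ⋯ ⟶ Sₙ ⟶ Sₙ₊₁` in `C`, exactness of
`0 ⟶ C(-, S₀) ⟶ C(-, S₁) ⟶ ⋯ ⟶ C(-, Sₙ) ⟶ C(-, Sₙ₊₁)`, tested objectwise. -/
def IsHomFromExact {n : ℕ} (S : ComposableArrows C (n + 1)) : Prop :=
  ∀ Z : C,
    Function.Injective (fun a : Z ⟶ S.obj' 0 => a ≫ S.map' 0 1) ∧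
    ∀ (i : ℕ) (hi : i < n),
      Function.Exact (fun a : Z ⟶ S.obj' i => a ≫ S.map' i (i + 1))
        (fun a : Z ⟶ S.obj' (i + 1) => a ≫ S.map' (i + 1) (i + 2))

/-- For a sequence `S₀ ⟶ S₁ ⟶ ⋯ ⟶ Sₙ ⟶ Sₙ₊₁` in `C`, exactness of
`0 ⟶ C(Sₙ₊₁, -) ⟶ C(Sₙ, -) ⟶ ⋯ ⟶ C(S₁, -) ⟶ C(S₀, -)`, tested objectwise. -/
def IsHomToExact {n : ℕ} (S : ComposableArrows C (n + 1)) : Prop :=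
  ∀ Z : C,
    Function.Injective (fun a : S.obj' (n + 1) ⟶ Z => S.map' n (n + 1) ≫ a) ∧
    ∀ (i : ℕ) (hi : i < n),
      Function.Exact (fun a : S.obj' (i + 2) ⟶ Z => S.map' (i + 1) (i + 2) ≫ a)
        (fun a : S.obj' (i + 1) ⟶ Z => S.map' i (i + 1) ≫ a)

/-- `S`, written `Xₙ ⟶ ⋯ ⟶ X₁ ⟶ X ⟶ Y`, consists of an `n`-kernel `Xₙ ⟶ ⋯ ⟶ X₁ ⟶ X` of `f`
followed by `f : X ⟶ Y` itself (the last arrow is identified with `f` by an isomorphism of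
arrows). -/
def IsNKernel {n : ℕ} (S : ComposableArrows C (n + 1)) {X Y : C} (f : X ⟶ Y) : Prop :=
  Nonempty (Arrow.mk (S.map' n (n + 1)) ≅ Arrow.mk f) ∧ IsHomFromExact S

/-- `S`, written `X ⟶ Y ⟶ Y₁ ⟶ ⋯ ⟶ Yₙ`, consists of `f : X ⟶ Y` itself (the first arrow is
identified with `f` by an isomorphism of arrows) followed by an `n`-cokernel
`Y ⟶ Y₁ ⟶ ⋯ ⟶ Yₙ` of `f`. -/
def IsNCokernel {n : ℕ} (S : ComposableArrows C (n + 1)) {X Y : C} (f : X ⟶ Y) : Prop :=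
  Nonempty (Arrow.mk (S.map' 0 1) ≅ Arrow.mk f) ∧ IsHomToExact S

variable (C) in
/-- `n`-abelian categories (for `n` positive). -/
structure IsNAbelian (n : ℕ) : Prop where
  hasZeroObject : HasZeroObject C
  hasFiniteBiproducts : HasFiniteBiproducts C
  isIdempotentComplete : IsIdempotentComplete C
  /-- every morphism has an `n`-kernel -/
  exists_nKernel : ∀ {X Y : C} (f : X ⟶ Y), ∃ S : ComposableArrows C (n + 1), IsNKernel S f
  /-- every morphism has an `n`-cokernel -/
  exists_nCokernel : ∀ {X Y : C} (f : X ⟶ Y), ∃ S : ComposableArrows C (n + 1), IsNCokernel S f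
  /-- a monomorphism followed by any `n`-cokernel `g₁, …, gₙ` of it is an `n`-kernel of `gₙ` -/
  isNKernel_of_mono : ∀ {X Y : C} (f : X ⟶ Y), Mono f →
    ∀ S : ComposableArrows C (n + 1), IsNCokernel S f → IsNKernel S (S.map' n (n + 1))
  /-- any `n`-kernel `fₙ, …, f₁` of an epimorphism followed by it is an `n`-cokernel of `fₙ` -/
  isNCokernel_of_epi : ∀ {X Y : C} (f : X ⟶ Y), Epi f →
    ∀ S : ComposableArrows C (n + 1), IsNKernel S f → IsNCokernel S (S.map' 0 1)

end NAbelian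

/-! ### Abelian categories as a property, and global dimension -/

/-- The preadditive category `C` is an abelian category. -/
class IsAbelianCategory (C : Type u) [Category.{v} C] [Preadditive C] : Prop extends
    IsNormalMonoCategory C, IsNormalEpiCategory C where
  hasFiniteProducts : HasFiniteProducts C
  hasKernels : HasKernels C
  hasCokernels : HasCokernels C

/-- The abelian category structure (with the given addition of morphisms). -/
abbrev IsAbelianCategory.toAbelian (C : Type u) [Category.{v} C] [Preadditive C]
    [h : IsAbelianCategory C] : Abelian C :=
  { (inferInstance : Preadditive C) with
    normalMonoOfMono := h.normalMonoOfMono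
    normalEpiOfEpi := h.normalEpiOfEpi
    has_finite_products := h.hasFiniteProducts
    has_kernels := h.hasKernels
    has_cokernels := h.hasCokernels }

/-- The global dimension of the abelian category `A` is at most `d`. -/
def GlobalDimensionLE (A : Type u) [Category.{v} A] [Abelian A] (d : ℕ) : Prop :=
  ∀ X : A, HasProjectiveDimensionLE X d

/-! ### Module categories

A left module over a ring `R` is an `R`-module, a right module is an `Rᵐᵒᵖ`-module. -/

/-- The category of finitely generated projective (left) `R`-modules. -/
abbrev FGProj (R : Type u) [Ring R] : Type (u + 1) :=
  ObjectProperty.FullSubcategory (C := ModuleCat.{u} R)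
    (fun M => Module.Finite R M ∧ Module.Projective R M)

/-- The category of finitely presented (left) `R`-modules. -/
abbrev FPMod (R : Type u) [Ring R] : Type (u + 1) :=
  ObjectProperty.FullSubcategory (C := ModuleCat.{u} R) (fun M => Module.FinitePresentation R M)

/-- `Λ` is right coherent: the category of finitely presented right `Λ`-modules is abelian. -/
abbrev IsRightCoherent (Λ : Type u) [Ring Λ] : Prop := IsAbelianCategory (FPMod Λᵐᵒᵖ)

/-- `Λ` is left coherent: the category of finitely presented left `Λ`-modules is abelian. -/
abbrev IsLeftCoherent (Λ : Type u) [Ring Λ] : Prop := IsAbelianCategory (FPMod Λ)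

noncomputable instance FPMod.instAbelian (R : Type u) [Ring R] [IsAbelianCategory (FPMod R)] :
    Abelian (FPMod R) :=
  IsAbelianCategory.toAbelian (FPMod R)

/-! ### Transposes and torsion free modules

The ring `Λ` is a bimodule over itself. We treat both sides at once with a bimodule `B` over `R`
and `S`: for right `Λ`-modules take `(R, S, B) = (Λᵐᵒᵖ, Λ, Λ)`, and for left `Λ`-modules take
`(R, S, B) = (Λ, Λᵐᵒᵖ, Λ)`. The dual of an `R`-module `P` is the `S`-module `P →ₗ[R] B`. -/

section Transpose

variable {R S : Type u} [Ring R] [Ring S]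
  (B : Type u) [AddCommGroup B] [Module R B] [Module S B] [SMulCommClass R S B]

/-- `T` is a transpose of `M`: there is a presentation `P --f--> Q --p--> M ⟶ 0` of `M` by finitely
generated projective modules, such that `T` is the cokernel of the dual
`f* : Hom_R(Q, B) ⟶ Hom_R(P, B)`, i.e. `Hom_R(Q, B) --f*--> Hom_R(P, B) --q--> T ⟶ 0` is exact. -/
def IsTranspose (M : FPMod R) (T : FPMod S) : Prop :=
  ∃ (P Q : FGProj R) (f : P.obj →ₗ[R] Q.obj) (p : Q.obj →ₗ[R] M.obj)
    (q : (P.obj →ₗ[R] B) →ₗ[S] T.obj),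
    Function.Exact f p ∧ Function.Surjective p ∧
    Function.Exact (LinearMap.lcomp S B f) q ∧ Function.Surjective q

/-- `M` is `k`-torsion free: `Ext^i(Tr M, B) = 0` for all `1 ≤ i ≤ k`, where `Tr M` is any transpose
of `M` and `Ext` is computed in the abelian category of finitely presented `S`-modules. -/
def IsTorsionFree [Module.FinitePresentation S B] [IsAbelianCategory (FPMod S)]
    (k : ℕ) (M : FPMod R) : Prop :=
  letI := HasExt.standard (FPMod S)
  ∀ T : FPMod S, IsTranspose B M T → ∀ i : ℕ, 1 ≤ i → i ≤ k →
    Subsingleton (Abelian.Ext T (⟨ModuleCat.of S B, ‹_›⟩ : FPMod S) i)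

end Transpose

/-- The right module `Λ` is finitely presented. -/
instance finitePresentation_mulOpposite_self (Λ : Type u) [Ring Λ] :
    Module.FinitePresentation Λᵐᵒᵖ Λ :=
  Module.FinitePresentation.of_equiv
    ({ MulOpposite.opAddEquiv.symm with
        map_smul' := fun a b => by simp } : Λᵐᵒᵖ ≃ₗ[Λᵐᵒᵖ] Λ)

/-- The right `Λ`-module `M` is `k`-torsion free (for `Λ` left coherent). -/
abbrev IsRightTorsionFree {Λ : Type u} [Ring Λ] [IsLeftCoherent Λ] (k : ℕ) (M : FPMod Λᵐᵒᵖ) :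
    Prop :=
  IsTorsionFree (R := Λᵐᵒᵖ) (S := Λ) Λ k M

/-- The left `Λ`-module `M` is `k`-torsion free (for `Λ` right coherent). -/
abbrev IsLeftTorsionFree {Λ : Type u} [Ring Λ] [IsRightCoherent Λ] (k : ℕ) (M : FPMod Λ) : Prop :=
  IsTorsionFree (R := Λ) (S := Λᵐᵒᵖ) Λ k M

-- Exactness under `Hom(-, -)` inside proj Λ is tested on Λ itself, so an n-kernel of f is a
-- finitely generated projective resolution of ker f with n terms. Applied to a presentation of a
-- module M, it resolves M in length n + 1. Thus n-kernels exist for all morphisms exactly when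
-- finitely presented modules are closed under kernels (coherence) and have projective dimension at
-- most n + 1.
--
-- The functor Hom(-, Λ) is a duality between the projectives on the two sides. It reverses
-- sequences, so n-cokernels on one side are n-kernels on the other, and the op-conditions come for
-- free.
--
-- For the last two axioms, let C be a map f followed by an n-cokernel. The dual of C is a
-- projective resolution of coker f*, a transpose of M = coker f, and dualizing once more returns C.
-- Hence Ext^i(Tr M, Λ) is the homology of C at its i-th inner place
-- (`HasCommonGenerator.subsingleton_ext_iff`). If f is mono, then pdim M ≤ 1, and C is an n-kernel
-- exactly when these Ext groups vanish. Conversely, if pdim M ≤ 1, any presentation of M has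
-- projective image, and restricting to that image makes it a monomorphism.
--
-- Both sides are treated at once by a bimodule B over R and S with a common free generator.

universe w

/-! ### Coherence in terms of modules -/

section ModuleCoherence

variable {R : Type u} [Ring R]

theorem LinearMap.exists_comp_eq_of_range_le {M N K : Type*} [AddCommGroup M] [Module R M]
    [AddCommGroup N] [Module R N] [AddCommGroup K] [Module R K] (f : M →ₗ[R] N) (k : K →ₗ[R] N)
    (hf : Function.Injective f) (h : ∀ x, k x ∈ LinearMap.range f) : ∃ l : K →ₗ[R] M, f ∘ₗ l = k :=
  ⟨(LinearEquiv.ofInjective f hf).symm ∘ₗ k.codRestrict _ h, by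
    ext x
    exact congrArg Subtype.val ((LinearEquiv.ofInjective f hf).apply_symm_apply ⟨k x, h x⟩)⟩

theorem LinearMap.exists_comp_eq_of_ker_le {M N K : Type*} [AddCommGroup M] [Module R M]
    [AddCommGroup N] [Module R N] [AddCommGroup K] [Module R K] (f : M →ₗ[R] N) (k : M →ₗ[R] K)
    (hf : Function.Surjective f) (h : ∀ x, f x = 0 → k x = 0) : ∃ l : N →ₗ[R] K, l ∘ₗ f = k :=
  ⟨(LinearMap.ker f).liftQ k h ∘ₗ (f.quotKerEquivOfSurjective hf).symm.toLinearMap, by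
    ext x
    have : (f.quotKerEquivOfSurjective hf).symm (f x) = (LinearMap.ker f).mkQ x := by
      rw [LinearEquiv.symm_apply_eq]; rfl
    simpa [this] using (LinearMap.ker f).liftQ_apply k x⟩

theorem LinearMap.exists_lift_of_projective {P M N : Type*} [AddCommGroup M] [Module R M]
    [AddCommGroup N] [Module R N] [AddCommGroup P] [Module R P] [Module.Projective R P]
    (f : M →ₗ[R] N) (k : P →ₗ[R] N) (h : ∀ x, k x ∈ LinearMap.range f) :
    ∃ l : P →ₗ[R] M, f ∘ₗ l = k := by
  obtain ⟨l, hl⟩ := Module.projective_lifting_property f.rangeRestrict (k.codRestrict _ h)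
    f.surjective_rangeRestrict
  exact ⟨l, by ext x; exact congrArg Subtype.val (LinearMap.congr_fun hl x)⟩

variable (R) in
/-- Kernels of homomorphisms between finitely presented modules are finitely presented. -/
def HasFPKernels : Prop :=
  ∀ ⦃M N : Type u⦄ [AddCommGroup M] [Module R M] [AddCommGroup N] [Module R N]
    [Module.FinitePresentation R M] [Module.FinitePresentation R N] (f : M →ₗ[R] N),
    Module.FinitePresentation R (LinearMap.ker f)

theorem HasFPKernels.range (h : HasFPKernels R) {M N : Type u} [AddCommGroup M] [Module R M]
    [AddCommGroup N] [Module R N] [Module.FinitePresentation R M] [Module.FinitePresentation R N]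
    (f : M →ₗ[R] N) : Module.FinitePresentation R (LinearMap.range f) :=
  have := h f
  Module.finitePresentation_of_surjective f.rangeRestrict f.surjective_rangeRestrict
    (by rw [LinearMap.ker_rangeRestrict]; exact Module.Finite.iff_fg.1 inferInstance)

theorem Module.FinitePresentation.quotient_range {M N : Type*} [AddCommGroup M] [Module R M]
    [AddCommGroup N] [Module R N] [Module.Finite R M] [Module.FinitePresentation R N]
    (f : M →ₗ[R] N) : Module.FinitePresentation R (N ⧸ LinearMap.range f) :=
  Module.finitePresentation_of_surjective (LinearMap.range f).mkQ (Submodule.mkQ_surjective _)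
    (by rw [Submodule.ker_mkQ]; exact Module.Finite.iff_fg.1 inferInstance)

/-- It suffices to know that kernels of maps between finitely generated projective modules are
finitely generated. -/
theorem HasFPKernels.of_finite_ker
    (h : ∀ ⦃P Q : Type u⦄ [AddCommGroup P] [Module R P] [AddCommGroup Q] [Module R Q]
      [Module.Finite R P] [Module.Projective R P] [Module.Finite R Q] [Module.Projective R Q]
      (f : P →ₗ[R] Q), (LinearMap.ker f).FG) : HasFPKernels R := by
  have key : ∀ ⦃M N : Type u⦄ [AddCommGroup M] [Module R M] [AddCommGroup N] [Module R N]
      [Module.FinitePresentation R M] [Module.FinitePresentation R N] (f : M →ₗ[R] N),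
      (LinearMap.ker f).FG := by
    intro M N _ _ _ _ _ _ f
    obtain ⟨a, p, hp⟩ := Module.Finite.exists_fin' R M
    obtain ⟨b, c, q, g, hq, hgq⟩ := Module.FinitePresentation.exists_fin' R N
    obtain ⟨l, hl⟩ := Module.projective_lifting_property q (f ∘ₗ p) hq
    -- With `l` lifting `f` to free covers, `p y` lies in the kernel of `f` iff `l y` is a relation
    -- of N, i.e. `l y + g z = 0` for some `z`.
    have hker : LinearMap.ker f = (LinearMap.ker (l.coprod g)).map
        (p ∘ₗ LinearMap.fst R (Fin a → R) (Fin c → R)) := by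
      ext x
      simp only [LinearMap.mem_ker, Submodule.mem_map, LinearMap.coe_comp, Function.comp_apply,
        LinearMap.fst_apply, Prod.exists, LinearMap.coprod_apply]
      constructor
      · intro hx
        obtain ⟨y, rfl⟩ := hp x
        have h0 : q (l y) = 0 := (LinearMap.congr_fun hl y).trans hx
        obtain ⟨z, hz⟩ := (hgq (l y)).1 h0
        exact ⟨y, -z, by simp [hz], rfl⟩
      · rintro ⟨y, z, hyz, rfl⟩
        have h1 : q (l y) = f (p y) := LinearMap.congr_fun hl y
        have h2 : q (l y) + q (g z) = 0 := by rw [← map_add, hyz, map_zero]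
        rwa [hgq.apply_apply_eq_zero, add_zero, h1] at h2
    rw [hker]
    exact (h _).map _
  intro M N _ _ _ _ _ _ f
  have : Module.Finite R (LinearMap.ker f) := Module.Finite.iff_fg.2 (key f)
  obtain ⟨a, p, hp⟩ := Module.Finite.exists_fin' R (LinearMap.ker f)
  refine Module.finitePresentation_of_surjective p hp ?_
  -- The relations of the kernel are themselves a kernel of a map into M, so `key` applies a second
  -- time.
  have : LinearMap.ker p = LinearMap.ker ((LinearMap.ker f).subtype ∘ₗ p) := by
    ext x; simp
  rw [this]
  exact key _

end ModuleCoherence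

/-! ### Finitely presented modules as an abelian category -/

section FullSubcategories

variable {R : Type u} [Ring R] {P : ObjectProperty (ModuleCat.{u} R)}

/-- The module R represents the underlying set, so it detects injectivity as soon as it belongs to
the subcategory. -/
theorem injective_of_mono_of_prop_self (hP : P (ModuleCat.of R R)) {X Y : P.FullSubcategory}
    (f : X ⟶ Y) [Mono f] : Function.Injective f.hom.hom := by
  rw [injective_iff_map_eq_zero]
  intro x hx
  let a : (⟨ModuleCat.of R R, hP⟩ : P.FullSubcategory) ⟶ X :=
    ObjectProperty.homMk (ModuleCat.ofHom (LinearMap.toSpanSingleton R X.obj x))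
  have ha : a ≫ f = 0 ≫ f := by
    ext
    simp [a, hx]
  have := congrArg (fun b : (⟨ModuleCat.of R R, hP⟩ : P.FullSubcategory) ⟶ X =>
    b.hom.hom (1 : R)) (Mono.right_cancellation _ _ ha)
  simpa [a] using this

theorem mono_of_injective {X Y : P.FullSubcategory} (f : X ⟶ Y)
    (hf : Function.Injective f.hom.hom) : Mono f := by
  have : Mono f.hom := (ModuleCat.mono_iff_injective _).2 hf
  exact P.ι.mono_of_mono_map this

theorem epi_of_surjective {X Y : P.FullSubcategory} (f : X ⟶ Y)
    (hf : Function.Surjective f.hom.hom) : Epi f := by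
  have : Epi f.hom := (ModuleCat.epi_iff_surjective _).2 hf
  exact P.ι.epi_of_epi_map this

/-- An isomorphism in a full subcategory of modules as a linear equivalence. -/
def linearEquivOfIso {X Y : P.FullSubcategory} (e : X ≅ Y) : X.obj ≃ₗ[R] Y.obj :=
  (P.ι.mapIso e).toLinearEquiv

end FullSubcategories

namespace FPMod

variable {R : Type u} [Ring R]

/-- A finitely presented module as an object of `FPMod R`. -/
abbrev of (R : Type u) [Ring R] (M : Type u) [AddCommGroup M] [Module R M]
    [h : Module.FinitePresentation R M] : FPMod R :=
  ⟨ModuleCat.of R M, h⟩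

/-- A linear map as a morphism of `FPMod R`. -/
abbrev ofHom {X Y : FPMod R} (f : X.obj →ₗ[R] Y.obj) : X ⟶ Y :=
  ObjectProperty.homMk (ModuleCat.ofHom f)

instance (X : FPMod R) : Module.FinitePresentation R X.obj := X.property

theorem injective_of_mono {X Y : FPMod R} (f : X ⟶ Y) [Mono f] : Function.Injective f.hom.hom :=
  injective_of_mono_of_prop_self (P := fun M => Module.FinitePresentation R M)
    (inferInstanceAs (Module.FinitePresentation R R)) f

/-- The module cokernel is again finitely presented, so it is available as a test object. For
projectives the analogue fails. -/
theorem surjective_of_epi {X Y : FPMod R} (f : X ⟶ Y) [Epi f] : Function.Surjective f.hom.hom := by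
  have := Module.FinitePresentation.quotient_range f.hom.hom
  let q : Y ⟶ FPMod.of R (Y.obj ⧸ LinearMap.range f.hom.hom) :=
    FPMod.ofHom (LinearMap.range f.hom.hom).mkQ
  have hq : f ≫ q = f ≫ 0 := by
    ext x
    simp [q]
  have h0 : q = 0 := Epi.left_cancellation _ _ hq
  rw [← LinearMap.range_eq_top, ← Submodule.ker_mkQ (LinearMap.range f.hom.hom),
    LinearMap.ker_eq_top]
  exact congrArg (fun b : Y ⟶ FPMod.of R (Y.obj ⧸ LinearMap.range f.hom.hom) => b.hom.hom) h0

/-- The categorical kernel is the module kernel: an element killed by `f` is a map from R that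
factors through `kernel.ι`. -/
theorem hasFPKernels [IsAbelianCategory (FPMod R)] : HasFPKernels R := by
  intro M N _ _ _ _ _ _ f
  let F : FPMod.of R M ⟶ FPMod.of R N := FPMod.ofHom f
  have hinj := injective_of_mono (kernel.ι F)
  have hr : LinearMap.range (kernel.ι F).hom.hom = LinearMap.ker f := by
    ext x
    constructor
    · rintro ⟨y, rfl⟩
      exact congrArg (fun b : kernel F ⟶ FPMod.of R N => b.hom.hom y) (kernel.condition F)
    · intro hx
      let a : FPMod.of R R ⟶ FPMod.of R M := FPMod.ofHom (LinearMap.toSpanSingleton R M x)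
      have ha : a ≫ F = 0 := by
        ext
        simpa [a, F] using hx
      refine ⟨(kernel.lift F a ha).hom.hom (1 : R), ?_⟩
      have := congrArg (fun b : FPMod.of R R ⟶ FPMod.of R M => b.hom.hom (1 : R))
        (kernel.lift_ι F a ha)
      refine this.trans ?_
      simp [a]
  rw [← hr]
  exact Module.FinitePresentation.of_equiv (LinearEquiv.ofInjective _ hinj)

end FPMod

/-- A full subcategory of modules closed under kernels, cokernels and finite products inherits the
abelian structure. -/
theorem HasFPKernels.isAbelianCategory {R : Type u} [Ring R] (h : HasFPKernels R) :
    IsAbelianCategory (FPMod R) := by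
  let P : ObjectProperty (ModuleCat.{u} R) := fun M => Module.FinitePresentation R M
  have : P.ContainsZero := ⟨ModuleCat.of R PUnit.{u + 1}, ModuleCat.isZero_of_subsingleton _,
    inferInstanceAs (Module.FinitePresentation R PUnit.{u + 1})⟩
  have iso {X Y : ModuleCat.{u} R} (e : X ≅ Y) (hX : P X) : P Y :=
    have : Module.FinitePresentation R X := hX
    Module.FinitePresentation.of_equiv e.toLinearEquiv
  have : P.IsClosedUnderIsomorphisms := ⟨iso⟩
  have : P.IsClosedUnderKernels := ⟨by
    rintro _ ⟨f, k, hk, hf⟩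
    have : Module.FinitePresentation R _ := hf.1
    have : Module.FinitePresentation R _ := hf.2
    exact iso ((ModuleCat.kernelIsLimit f).conePointUniqueUpToIso hk) (h f.hom)⟩
  have : P.IsClosedUnderCokernels := ⟨by
    rintro _ ⟨f, k, hk, hf⟩
    have : Module.FinitePresentation R _ := hf.1
    have : Module.FinitePresentation R _ := hf.2
    exact iso ((ModuleCat.cokernelIsColimit f).coconePointUniqueUpToIso hk)
      (Module.FinitePresentation.quotient_range f.hom)⟩
  have : P.IsClosedUnderBinaryProducts := ⟨by
    rintro X ⟨p⟩
    have h1 : Module.FinitePresentation R (p.diag.obj ⟨.left⟩) := p.prop_diag_obj _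
    have h2 : Module.FinitePresentation R (p.diag.obj ⟨.right⟩) := p.prop_diag_obj _
    have hlim := (IsLimit.postcomposeHomEquiv (diagramIsoPair p.diag) _).symm p.isLimit
    exact iso ((ModuleCat.binaryProductLimitCone _ _).isLimit.conePointUniqueUpToIso hlim)
      (Module.FinitePresentation.prod (p.diag.obj ⟨.left⟩) (p.diag.obj ⟨.right⟩))⟩
  have : P.IsClosedUnderFiniteProducts := .mk'
  exact { hasFiniteProducts := inferInstanceAs (HasFiniteProducts P.FullSubcategory)
          hasKernels := inferInstanceAs (HasKernels P.FullSubcategory)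
          hasCokernels := inferInstanceAs (HasCokernels P.FullSubcategory)
          toIsNormalMonoCategory := inferInstanceAs (IsNormalMonoCategory P.FullSubcategory)
          toIsNormalEpiCategory := inferInstanceAs (IsNormalEpiCategory P.FullSubcategory) }

/-! ### Ext along a short exact sequence with projective middle term -/

namespace CategoryTheory.ShortComplex.ShortExact

open Abelian

variable {C : Type u} [Category.{v} C] [Abelian C] [HasExt.{w} C] {S : ShortComplex C}

/-- By the long exact sequence, Ext¹ of the quotient is the cokernel of restriction from the middle
term to the subobject. -/
theorem subsingleton_ext_one_iff (hS : S.ShortExact) [Projective S.X₂] (Y : C) :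
    Subsingleton (Ext S.X₃ Y 1) ↔ ∀ h : S.X₁ ⟶ Y, ∃ h' : S.X₂ ⟶ Y, S.f ≫ h' = h := by
  constructor
  · intro _ h
    obtain ⟨x, hx⟩ := Ext.contravariant_sequence_exact₁ hS _ (Ext.mk₀ h) (add_zero 1)
      (Subsingleton.elim _ _)
    obtain ⟨h', rfl⟩ := Ext.homEquiv₀.symm.surjective x
    exact ⟨h', Ext.homEquiv₀.symm.injective (by simpa using hx)⟩
  · intro h
    refine subsingleton_of_forall_eq 0 fun x => ?_
    obtain ⟨y, rfl⟩ := Ext.contravariant_sequence_exact₃ hS _ x (Ext.eq_zero_of_projective _)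
      (add_zero 1)
    obtain ⟨y, rfl⟩ := Ext.homEquiv₀.symm.surjective y
    obtain ⟨h', rfl⟩ := h y
    rw [Ext.homEquiv₀_symm_apply, ← Ext.mk₀_comp_mk₀, hS.extClass_comp_assoc]

theorem subsingleton_ext_add_two_iff (hS : S.ShortExact) [Projective S.X₂] (Y : C) (i : ℕ) :
    Subsingleton (Ext S.X₃ Y (i + 2)) ↔ Subsingleton (Ext S.X₁ Y (i + 1)) := by
  constructor
  · intro _
    refine subsingleton_of_forall_eq 0 fun x => ?_
    obtain ⟨y, rfl⟩ := Ext.contravariant_sequence_exact₁ hS _ x (add_comm 1 (i + 1))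
      (Subsingleton.elim _ _)
    rw [y.eq_zero_of_projective, Ext.comp_zero]
  · intro _
    refine subsingleton_of_forall_eq 0 fun x => ?_
    obtain ⟨y, rfl⟩ := Ext.contravariant_sequence_exact₃ hS _ x (Ext.eq_zero_of_projective _)
      (add_comm 1 (i + 1))
    rw [Subsingleton.elim y 0, Ext.comp_zero]

end CategoryTheory.ShortComplex.ShortExact

/-! ### Short exact sequences and projectives among finitely presented modules -/

namespace FPMod

variable {R : Type u} [Ring R]

/-- The short complex of `FPMod R` given by an exact pair of linear maps. -/
abbrev shortComplex {X Y Z : FPMod R} (f : X.obj →ₗ[R] Y.obj) (g : Y.obj →ₗ[R] Z.obj)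
    (h : Function.Exact f g) : ShortComplex (FPMod R) :=
  ShortComplex.mk (ofHom f) (ofHom g) (by ext x; exact h.apply_apply_eq_zero x)

theorem shortExact [IsAbelianCategory (FPMod R)] {X Y Z : FPMod R} (f : X.obj →ₗ[R] Y.obj)
    (g : Y.obj →ₗ[R] Z.obj) (h : Function.Exact f g) (hf : Function.Injective f)
    (hg : Function.Surjective g) : (shortComplex f g h).ShortExact where
  mono_f := mono_of_injective _ hf
  epi_g := epi_of_surjective _ hg
  exact := by
    have := mono_of_injective (ofHom f) hf
    refine ShortComplex.exact_of_f_is_kernel _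
      (KernelFork.IsLimit.ofι' (ofHom f) (shortComplex f g h).zero fun {A} k hk => ?_)
    have hl := LinearMap.exists_comp_eq_of_range_le f k.hom.hom hf fun x => (h _).1
      (congrArg (fun b : A ⟶ Z => b.hom.hom x) hk)
    exact ⟨ofHom hl.choose, by ext x; exact LinearMap.congr_fun hl.choose_spec x⟩

theorem projective_of_moduleProjective (M : FPMod R) [Module.Projective R M.obj] :
    Projective M where
  factors {E X} f e _ := by
    obtain ⟨l, hl⟩ := Module.projective_lifting_property e.hom.hom f.hom.hom (surjective_of_epi e)
    exact ⟨ofHom l, by ext x; exact LinearMap.congr_fun hl x⟩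

theorem moduleProjective (M : FPMod R) [Projective M] : Module.Projective R M.obj := by
  obtain ⟨a, p, hp⟩ := Module.Finite.exists_fin' R M.obj
  let e : FPMod.of R (Fin a → R) ⟶ M := FPMod.ofHom p
  have : Epi e := epi_of_surjective e hp
  refine Module.Projective.of_split (Projective.factorThru (𝟙 M) e).hom.hom p ?_
  ext x
  exact congrArg (fun b : M ⟶ M => b.hom.hom x) (Projective.factorThru_comp (𝟙 M) e)

end FPMod

/-! ### Finitely generated projectives: additive and idempotent complete -/

namespace FGProj

variable {R : Type u} [Ring R]

/-- A finitely generated projective module as an object of `FGProj R`. -/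
abbrev of (R : Type u) [Ring R] (M : Type u) [AddCommGroup M] [Module R M]
    [h₁ : Module.Finite R M] [h₂ : Module.Projective R M] : FGProj R :=
  ⟨ModuleCat.of R M, h₁, h₂⟩

/-- A linear map as a morphism of `FGProj R`. -/
abbrev ofHom {X Y : FGProj R} (f : X.obj →ₗ[R] Y.obj) : X ⟶ Y :=
  ObjectProperty.homMk (ModuleCat.ofHom f)

instance (X : FGProj R) : Module.Finite R X.obj := X.property.1
instance (X : FGProj R) : Module.Projective R X.obj := X.property.2
instance (X : FGProj R) : Module.FinitePresentation R X.obj :=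
  Module.finitePresentation_of_projective R X.obj

/-- A finitely generated projective module as a finitely presented module. -/
abbrev toFPMod (X : FGProj R) : FPMod R := FPMod.of R X.obj

instance (X : FGProj R) : Projective X.toFPMod := FPMod.projective_of_moduleProjective _

theorem injective_of_mono {X Y : FGProj R} (f : X ⟶ Y) [Mono f] : Function.Injective f.hom.hom :=
  injective_of_mono_of_prop_self
    (P := fun M : ModuleCat.{u} R => Module.Finite R M ∧ Module.Projective R M)
    ⟨inferInstanceAs (Module.Finite R R), inferInstanceAs (Module.Projective R R)⟩ f

variable (R)

theorem hasZeroObject : HasZeroObject (FGProj R) :=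
  ⟨FGProj.of R PUnit.{u + 1}, by
    rw [IsZero.iff_id_eq_zero]
    ext x⟩

theorem hasFiniteBiproducts : HasFiniteBiproducts (FGProj R) := by
  have := hasZeroObject R
  have : HasBinaryBiproducts (FGProj R) := ⟨fun X Y => HasBinaryBiproduct.mk
    { bicone :=
        { pt := FGProj.of R (X.obj × Y.obj)
          fst := FGProj.ofHom (LinearMap.fst R X.obj Y.obj)
          snd := FGProj.ofHom (LinearMap.snd R X.obj Y.obj)
          inl := FGProj.ofHom (LinearMap.inl R X.obj Y.obj)
          inr := FGProj.ofHom (LinearMap.inr R X.obj Y.obj)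
          inl_fst := by ext x; rfl
          inl_snd := by ext x; rfl
          inr_fst := by ext x; rfl
          inr_snd := by ext x; rfl }
      isBilimit := isBinaryBilimitOfTotal _ (by
        ext x
        exacts [add_zero (M := X.obj) x, add_zero (M := Y.obj) 0, add_zero (M := X.obj) 0,
          zero_add (M := Y.obj) x]) }⟩
  have : HasFiniteProducts (FGProj R) := hasFiniteProducts_of_has_binary_and_terminal
  exact HasFiniteBiproducts.of_hasFiniteProducts

theorem isIdempotentComplete : IsIdempotentComplete (FGProj R) := ⟨fun X p hp => by
  have hpp : ∀ x, p.hom.hom (p.hom.hom x) = p.hom.hom x := fun x =>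
    congrArg (fun b : X ⟶ X => b.hom.hom x) hp
  have hs : p.hom.hom.rangeRestrict ∘ₗ (LinearMap.range p.hom.hom).subtype = LinearMap.id := by
    ext ⟨_, y, rfl⟩
    exact hpp y
  have : Module.Projective R (LinearMap.range p.hom.hom) := Module.Projective.of_split _ _ hs
  refine ⟨FGProj.of R (LinearMap.range p.hom.hom),
    FGProj.ofHom (LinearMap.range p.hom.hom).subtype, FGProj.ofHom p.hom.hom.rangeRestrict, ?_, ?_⟩
  · ext x
    exact congrArg Subtype.val (LinearMap.congr_fun hs x)
  · ext x
    rfl⟩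

end FGProj

/-! ### Duality between projectives on the two sides -/

section Duality

variable {R S : Type u} [Ring R] [Ring S] (B : Type u) [AddCommGroup B] [Module R B] [Module S B]

variable (R S) in
/-- The bimodule `B` is free of rank one on both sides, with a common generator. -/
def HasCommonGenerator : Prop :=
  ∃ e : B, Function.Bijective (fun r : R => r • e) ∧ Function.Bijective (fun s : S => s • e)

theorem HasCommonGenerator.symm {B : Type u} [AddCommGroup B] [Module R B] [Module S B]
    (h : HasCommonGenerator R S B) : HasCommonGenerator S R B :=
  h.imp fun _ => And.symm

theorem HasCommonGenerator.exists_linearEquiv {B : Type u} [AddCommGroup B] [Module R B]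
    [Module S B] (h : HasCommonGenerator R S B) : Nonempty (R ≃ₗ[R] B) :=
  let ⟨e, he, _⟩ := h
  ⟨LinearEquiv.ofBijective (LinearMap.toSpanSingleton R B e) he⟩

variable [SMulCommClass R S B]

/-- The dual basis lemma with functionals valued in B. Since `ρ` and `σ` give coordinates along the
same `e`, commuting the two actions on `e` trades R-scalars for S-scalars. -/
theorem HasCommonGenerator.exists_dualBasis {B : Type u} [AddCommGroup B] [Module R B]
    [Module S B] [SMulCommClass R S B] (h : HasCommonGenerator R S B) (P : Type u)
    [AddCommGroup P] [Module R P] [Module.Finite R P] [Module.Projective R P] :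
    ∃ (e : B) (ρ : B →ₗ[R] R) (σ : B →ₗ[S] S) (n : ℕ) (x : Fin n → P) (f : Fin n → P →ₗ[R] B),
      (∀ b, ρ b • e = b) ∧ (∀ b, σ b • e = b) ∧ ∀ y, ∑ i, ρ (f i y) • x i = y := by
  obtain ⟨e, h₁, h₂⟩ := h
  let α : R ≃ₗ[R] B := LinearEquiv.ofBijective (LinearMap.toSpanSingleton R B e) h₁
  let β : S ≃ₗ[S] B := LinearEquiv.ofBijective (LinearMap.toSpanSingleton S B e) h₂
  obtain ⟨n, p, g, hp, hg, hpg⟩ := Module.Finite.exists_comp_eq_id_of_projective R P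
  refine ⟨e, α.symm, β.symm, n, fun i => p (Pi.single i 1),
    fun i => α.toLinearMap ∘ₗ LinearMap.proj i ∘ₗ g, fun b => α.apply_symm_apply b,
    fun b => β.apply_symm_apply b, fun y => ?_⟩
  have : ∑ i, g y i • (Pi.single i 1 : Fin n → R) = g y := by
    ext j
    simp [Finset.sum_apply, Pi.single_apply]
  calc _ = p (∑ i, g y i • (Pi.single i 1 : Fin n → R)) := by simp
    _ = y := by rw [this]; exact LinearMap.congr_fun hpg y

variable [SMulCommClass S R B]

variable (R S) in
/-- The evaluation map of `P` into its double dual with respect to `B`. -/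
def doubleDualEval (P : Type u) [AddCommGroup P] [Module R P] :
    P →ₗ[R] ((P →ₗ[R] B) →ₗ[S] B) where
  toFun x := { toFun := fun f => f x, map_add' := fun _ _ => rfl, map_smul' := fun _ _ => rfl }
  map_add' x y := by ext f; exact f.map_add x y
  map_smul' r x := by ext f; exact f.map_smul r x

@[simp]
theorem doubleDualEval_apply (P : Type u) [AddCommGroup P] [Module R P] (x : P) (f : P →ₗ[R] B) :
    doubleDualEval R S B P x f = f x := rfl

variable {B} (h : HasCommonGenerator R S B) (P : Type u) [AddCommGroup P] [Module R P]
  [Module.Finite R P] [Module.Projective R P]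
include h

/-- The functionals `f i` of a dual basis separate points and generate the dual over S, so an
element of the double dual is determined by its values on them. -/
theorem HasCommonGenerator.doubleDualEval_bijective :
    Function.Bijective (doubleDualEval R S B P) := by
  obtain ⟨e, ρ, σ, n, x, f, hρ, hσ, hx⟩ := h.exists_dualBasis P
  constructor
  · rw [injective_iff_map_eq_zero]
    intro y hy
    rw [← hx y]
    refine Finset.sum_eq_zero fun i _ => ?_
    have : f i y = 0 := LinearMap.congr_fun hy (f i)
    rw [this, map_zero, zero_smul]
  · intro Φ
    refine ⟨∑ i, ρ (Φ (f i)) • x i, ?_⟩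
    ext φ
    have hφ : φ = ∑ i, σ (φ (x i)) • f i := by
      ext y
      conv_lhs => rw [← hx y]
      simp only [map_sum, map_smul, LinearMap.sum_apply, LinearMap.smul_apply]
      refine Finset.sum_congr rfl fun i _ => ?_
      conv_lhs => rw [← hσ (φ (x i)), smul_comm, hρ]
    change φ (∑ i, ρ (Φ (f i)) • x i) = Φ φ
    conv_rhs => rw [hφ]
    simp only [map_sum, map_smul]
    refine Finset.sum_congr rfl fun i _ => ?_
    conv_rhs => rw [← hρ (Φ (f i)), smul_comm, hσ]

theorem HasCommonGenerator.dual_finite_projective :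
    Module.Finite S (P →ₗ[R] B) ∧ Module.Projective S (P →ₗ[R] B) := by
  obtain ⟨e, ρ, σ, n, x, f, hρ, hσ, hx⟩ := h.exists_dualBasis P
  let p : (Fin n → S) →ₗ[S] (P →ₗ[R] B) := Fintype.linearCombination S f
  let g : (P →ₗ[R] B) →ₗ[S] (Fin n → S) :=
    LinearMap.pi fun i => σ ∘ₗ doubleDualEval R S B P (x i)
  have hpg : p ∘ₗ g = LinearMap.id := by
    ext φ y
    conv_rhs => rw [LinearMap.id_apply, ← hx y]
    simp only [p, g, LinearMap.comp_apply, Fintype.linearCombination_apply, LinearMap.pi_apply,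
      doubleDualEval_apply, map_sum, map_smul, LinearMap.sum_apply, LinearMap.smul_apply]
    refine Finset.sum_congr rfl fun i _ => ?_
    conv_rhs => rw [← hσ (φ (x i)), smul_comm, hρ]
  exact ⟨Module.Finite.of_surjective p fun φ => ⟨g φ, LinearMap.congr_fun hpg φ⟩,
    Module.Projective.of_split g p hpg⟩

end Duality

section DualFunctor

variable {R S : Type u} [Ring R] [Ring S] {B : Type u} [AddCommGroup B] [Module R B] [Module S B]
  [SMulCommClass R S B] [SMulCommClass S R B] (h : HasCommonGenerator R S B)

/-- The duality `Hom(-, B)` on finitely generated projective modules. -/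
def HasCommonGenerator.dual : (FGProj R)ᵒᵖ ⥤ FGProj S where
  obj P := ⟨ModuleCat.of S (P.unop.obj →ₗ[R] B), h.dual_finite_projective P.unop.obj⟩
  map f := FGProj.ofHom (LinearMap.lcomp S B f.unop.hom.hom)

theorem HasCommonGenerator.dual_faithful : h.dual.Faithful where
  map_injective {X Y} f g hfg := by
    apply Quiver.Hom.unop_inj
    ext x
    apply (h.doubleDualEval_bijective _).1
    ext φ
    exact LinearMap.congr_fun (congrArg (fun b => b.hom.hom φ) hfg) x

theorem HasCommonGenerator.dual_full : h.dual.Full where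
  map_surjective {X Y} g := by
    let ev := LinearEquiv.ofBijective _ (h.doubleDualEval_bijective X.unop.obj)
    -- The preimage of `g` is its own dual, conjugated by the evaluation isomorphisms.
    let f : Y.unop.obj →ₗ[R] X.unop.obj := ev.symm.toLinearMap ∘ₗ
      LinearMap.lcomp R B g.hom.hom ∘ₗ doubleDualEval R S B Y.unop.obj
    refine ⟨Quiver.Hom.op (FGProj.ofHom f), ?_⟩
    ext φ
    refine LinearMap.ext fun y => ?_
    have : ev (f y) = LinearMap.lcomp R B g.hom.hom (doubleDualEval R S B Y.unop.obj y) :=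
      ev.apply_symm_apply _
    exact LinearMap.congr_fun this φ

theorem HasCommonGenerator.dual_essSurj : h.dual.EssSurj where
  mem_essImage N := by
    let ev := LinearEquiv.ofBijective _ (h.symm.doubleDualEval_bijective N.obj)
    exact ⟨.op (h.symm.dual.obj (.op N)),
      ⟨ObjectProperty.isoMk _ ev.symm.toModuleIso⟩⟩

theorem HasCommonGenerator.dual_isEquivalence : h.dual.IsEquivalence where
  faithful := h.dual_faithful
  full := h.dual_full
  essSurj := h.dual_essSurj

end DualFunctor

/-! ### n-kernels as projective resolutions -/

namespace FPMod

variable {R : Type u} [Ring R] [IsAbelianCategory (FPMod R)] {X Y Z : FPMod R}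
  (f : X.obj →ₗ[R] Y.obj) (g : Y.obj →ₗ[R] Z.obj) (h : Function.Exact f g)
  (hf : Function.Injective f) (hg : Function.Surjective g)
include h hf hg

/-- Passing to a syzygy lowers the dimension by one. The bound `1 ≤ m` leaves room for the
projective middle term. -/
theorem hasProjectiveDimensionLT_X₁ [Module.Projective R Y.obj] {m : ℕ} (hm : 1 ≤ m)
    (hZ : HasProjectiveDimensionLT Z (m + 1)) : HasProjectiveDimensionLT X m :=
  have := projective_of_moduleProjective Y
  (shortExact f g h hf hg).hasProjectiveDimensionLT_X₁ m (hasProjectiveDimensionLT_of_ge Y 1 m hm)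
    hZ

theorem hasProjectiveDimensionLT_X₃ [Module.Projective R Y.obj] {m : ℕ}
    (hX : HasProjectiveDimensionLT X m) : HasProjectiveDimensionLT Z (m + 1) :=
  have := projective_of_moduleProjective Y
  (shortExact f g h hf hg).hasProjectiveDimensionLT_X₃ m hX
    (hasProjectiveDimensionLT_of_ge Y 1 _ (by omega))

end FPMod

namespace FGProj

variable {R : Type u} [Ring R]

/-- Testing on R reads off elements; conversely a projective test object lifts through the image. -/
theorem homFrom_exact_iff {X Y Z : FGProj R} (f : X ⟶ Y) (g : Y ⟶ Z) :
    (∀ W : FGProj R, Function.Exact (fun a : W ⟶ X => a ≫ f) (fun a : W ⟶ Y => a ≫ g)) ↔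
      Function.Exact f.hom.hom g.hom.hom := by
  constructor
  · intro h y
    constructor
    · intro hy
      obtain ⟨a, ha⟩ := (h (FGProj.of R R)
        (FGProj.ofHom (LinearMap.toSpanSingleton R Y.obj y))).1 (by
          ext
          simpa using hy)
      refine ⟨a.hom.hom (1 : R), ?_⟩
      refine (congrArg (fun b : FGProj.of R R ⟶ Y => b.hom.hom (1 : R)) ha).trans ?_
      simp
    · rintro ⟨x, rfl⟩
      have h0 : 𝟙 X ≫ f ≫ g = 0 := by
        rw [← Category.assoc]
        exact (h X).apply_apply_eq_zero (𝟙 X)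
      rw [Category.id_comp] at h0
      exact congrArg (fun b : X ⟶ Z => b.hom.hom x) h0
  · intro h W a
    constructor
    · intro ha
      obtain ⟨l, hl⟩ := LinearMap.exists_lift_of_projective f.hom.hom a.hom.hom fun x => (h _).1
        (congrArg (fun b : W ⟶ Z => b.hom.hom x) ha)
      exact ⟨FGProj.ofHom l, by ext x; exact LinearMap.congr_fun hl x⟩
    · rintro ⟨c, rfl⟩
      ext x
      exact h.apply_apply_eq_zero (c.hom.hom x)

theorem isHomFromExact_iff {n : ℕ} (C : ComposableArrows (FGProj R) (n + 1)) :
    IsHomFromExact C ↔ Function.Injective (C.map' 0 1).hom.hom ∧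
      ∀ (i : ℕ) (hi : i < n), Function.Exact (C.map' i (i + 1)).hom.hom
        (C.map' (i + 1) (i + 2)).hom.hom := by
  constructor
  · intro h
    refine ⟨?_, fun i hi => (homFrom_exact_iff _ _).1 fun W => (h W).2 i hi⟩
    have : Mono (C.map' 0 1) := ⟨fun a b hab => (h _).1 hab⟩
    exact injective_of_mono _
  · intro h W
    refine ⟨?_, fun i hi => (homFrom_exact_iff _ _).2 (h.2 i hi) W⟩
    have : Mono (C.map' 0 1) := mono_of_injective _ h.1
    exact fun a b hab => (cancel_mono _).1 hab

/-- An isomorphism of arrows, in terms of modules. -/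
theorem exists_linearEquiv_of_arrow_iso {X Y X' Y' : FGProj R} {f : X ⟶ Y} {g : X' ⟶ Y'}
    (e : Arrow.mk f ≅ Arrow.mk g) : ∃ (a : X.obj ≃ₗ[R] X'.obj) (b : Y.obj ≃ₗ[R] Y'.obj),
      ∀ x, g.hom.hom (a x) = b (f.hom.hom x) :=
  ⟨linearEquivOfIso (Arrow.leftFunc.mapIso e), linearEquivOfIso (Arrow.rightFunc.mapIso e),
    fun x => congrArg (fun c : X ⟶ Y' => c.hom.hom x) e.hom.w⟩

/-- Since n is positive, an n-kernel has a term mapping onto the kernel, which is therefore finitely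
generated. -/
theorem hasFPKernels_of_exists_nKernel {n : ℕ} (hn : 0 < n)
    (h : ∀ {X Y : FGProj R} (f : X ⟶ Y), ∃ C : ComposableArrows (FGProj R) (n + 1),
      IsNKernel C f) : HasFPKernels R := by
  obtain ⟨m, rfl⟩ : ∃ m, n = m + 1 := ⟨n - 1, by omega⟩
  refine .of_finite_ker fun P Q _ _ _ _ _ _ _ _ f => ?_
  obtain ⟨C, ⟨e⟩, hC⟩ := h (FGProj.ofHom (X := FGProj.of R P) (Y := FGProj.of R Q) f)
  obtain ⟨a, b, hab⟩ := exists_linearEquiv_of_arrow_iso e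
  have hex := ((isHomFromExact_iff C).1 hC).2 m (by omega)
  have hker : LinearMap.ker f = (LinearMap.range (C.map' m (m + 1)).hom.hom).map
      (a : _ →ₗ[R] P) := by
    rw [← LinearMap.exact_iff.1 hex]
    ext x
    obtain ⟨y, rfl⟩ := a.surjective x
    have := hab y
    simp only [LinearMap.mem_ker, Submodule.mem_map, LinearEquiv.coe_coe,
      EmbeddingLike.apply_eq_iff_eq, exists_eq_right]
    erw [this]
    exact map_eq_zero_iff b b.injective
  rw [hker]
  exact (Module.Finite.iff_fg.1 inferInstance : (LinearMap.range _).FG).map _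

/-- The sequence up to place `i + 1` is a projective resolution of M; the induction splits it at the
image of its last map. -/
theorem hasProjectiveDimensionLE_of_isHomFromExact [IsAbelianCategory (FPMod R)] {n : ℕ}
    (C : ComposableArrows (FGProj R) (n + 1)) (hC : IsHomFromExact C) (i : ℕ) (hi : i ≤ n)
    (M : FPMod R) (p : (C.obj' (i + 1)).obj →ₗ[R] M.obj) (hp : Function.Surjective p)
    (hex : Function.Exact (C.map' i (i + 1)).hom.hom p) : HasProjectiveDimensionLE M (i + 1) := by
  rw [isHomFromExact_iff] at hC
  induction i generalizing M with
  | zero =>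
    have := (projective_iff_hasProjectiveDimensionLT_one (X := (C.obj' 0).toFPMod)).1
      (FPMod.projective_of_moduleProjective _)
    exact FPMod.hasProjectiveDimensionLT_X₃ (X := (C.obj' 0).toFPMod) (Y := (C.obj' 1).toFPMod)
      _ p hex hC.1 hp this
  | succ i ih =>
    let d : (C.obj' (i + 1)).obj →ₗ[R] (C.obj' (i + 2)).obj := (C.map' (i + 1) (i + 2)).hom.hom
    have := FPMod.hasFPKernels.range d
    refine FPMod.hasProjectiveDimensionLT_X₃ (X := FPMod.of R (LinearMap.range d))
      (Y := (C.obj' (i + 2)).toFPMod) (Submodule.subtype _) p ?_ (Submodule.subtype_injective _)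
      hp (ih (by omega) (FPMod.of R (LinearMap.range d)) d.rangeRestrict
        d.surjective_rangeRestrict ?_)
    · rw [LinearMap.exact_iff] at hex ⊢
      rw [hex, Submodule.range_subtype]
    · have := hC.2 i (by omega)
      rw [LinearMap.exact_iff] at this ⊢
      rw [LinearMap.ker_rangeRestrict, ← this]

theorem globalDimensionLE_of_exists_nKernel [IsAbelianCategory (FPMod R)] {n : ℕ}
    (h : ∀ {X Y : FGProj R} (f : X ⟶ Y), ∃ C : ComposableArrows (FGProj R) (n + 1),
      IsNKernel C f) : GlobalDimensionLE (FPMod R) (n + 1) := by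
  intro M
  obtain ⟨a, b, p, f, hp, hfp⟩ := Module.FinitePresentation.exists_fin' R M.obj
  obtain ⟨C, ⟨e⟩, hC⟩ := h (FGProj.ofHom (X := FGProj.of R (Fin b → R))
    (Y := FGProj.of R (Fin a → R)) f)
  obtain ⟨α, β, hαβ⟩ := exists_linearEquiv_of_arrow_iso e
  refine hasProjectiveDimensionLE_of_isHomFromExact C hC n le_rfl M (p ∘ₗ (β : _ →ₗ[R] _))
    (hp.comp β.surjective) fun x => ?_
  refine (hfp (β x)).trans ⟨?_, ?_⟩
  · rintro ⟨y, hy⟩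
    obtain ⟨z, rfl⟩ := α.surjective y
    exact ⟨z, β.injective ((hαβ z).symm.trans hy)⟩
  · rintro ⟨z, rfl⟩
    exact ⟨α z, hαβ z⟩

end FGProj

namespace FPMod

variable {R : Type u} [Ring R] [IsAbelianCategory (FPMod R)]

/-- For `m = 0` the syzygy must vanish, so the projective K covers itself; otherwise any free cover
works. -/
theorem exists_syzygy (K : FPMod R) (m : ℕ) (hK : HasProjectiveDimensionLT K (m + 1)) :
    ∃ (P : FGProj R) (p : P.obj →ₗ[R] K.obj) (K' : FPMod R) (ι : K'.obj →ₗ[R] P.obj),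
      Function.Surjective p ∧ Function.Injective ι ∧ Function.Exact ι p ∧
        HasProjectiveDimensionLT K' m := by
  cases m with
  | zero =>
    have : Projective K := projective_iff_hasProjectiveDimensionLT_one.2 hK
    have := moduleProjective K
    refine ⟨FGProj.of R K.obj, LinearMap.id, FPMod.of R PUnit.{u + 1}, 0, Function.surjective_id,
      Function.injective_of_subsingleton _, fun x => ?_, IsZero.hasProjectiveDimensionLT_zero ?_⟩
    · simp [eq_comm]
    · rw [IsZero.iff_id_eq_zero]
      ext x
  | succ m =>
    obtain ⟨a, p, hp⟩ := Module.Finite.exists_fin' R K.obj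
    have := hasFPKernels p
    refine ⟨FGProj.of R (Fin a → R), p, FPMod.of R (LinearMap.ker p), Submodule.subtype _, hp,
      Submodule.subtype_injective _, p.exact_subtype_ker_map, ?_⟩
    exact hasProjectiveDimensionLT_X₁ (X := FPMod.of R (LinearMap.ker p))
      (Y := (FGProj.of R (Fin a → R)).toFPMod) (Submodule.subtype _) p p.exact_subtype_ker_map
      (Submodule.subtype_injective _) hp (by omega) hK

end FPMod

namespace FGProj

variable {R : Type u} [Ring R] [IsAbelianCategory (FPMod R)]

theorem exists_nKernel {n : ℕ} (hn : 0 < n) (hg : GlobalDimensionLE (FPMod R) (n + 1))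
    {X Y : FGProj R} (f : X ⟶ Y) : ∃ C : ComposableArrows (FGProj R) (n + 1), IsNKernel C f := by
  -- After k steps of resolving to the left, the kernel K still to be resolved has dimension below
  -- `m = n - k`. It starts below n because ker f is a second syzygy of coker f; at `k = n` it is
  -- zero.
  have key : ∀ k m : ℕ, k + m = n → ∃ C : ComposableArrows (FGProj R) (k + 1),
      Nonempty (Arrow.mk (C.map' k (k + 1)) ≅ Arrow.mk f) ∧
      (∀ (i : ℕ) (hi : i < k), Function.Exact (C.map' i (i + 1)).hom.hom
        (C.map' (i + 1) (i + 2)).hom.hom) ∧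
      ∃ (K : FPMod R) (ι : K.obj →ₗ[R] (C.obj' 0).obj), Function.Injective ι ∧
        Function.Exact ι (C.map' 0 1).hom.hom ∧ HasProjectiveDimensionLT K m := by
    intro k
    induction k with
    | zero =>
      rintro m h
      obtain rfl : m = n := by omega
      refine ⟨ComposableArrows.mk₁ f, ⟨Iso.refl _⟩, fun i hi => absurd hi (by omega), ?_⟩
      have h1 := Module.FinitePresentation.quotient_range f.hom.hom
      have h2 := FPMod.hasFPKernels.range f.hom.hom
      have h3 := FPMod.hasFPKernels f.hom.hom
      refine ⟨FPMod.of R (LinearMap.ker f.hom.hom), Submodule.subtype _,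
        Submodule.subtype_injective _, f.hom.hom.exact_subtype_ker_map, ?_⟩
      have hr : HasProjectiveDimensionLT (FPMod.of R (LinearMap.range f.hom.hom)) (m + 1) :=
        FPMod.hasProjectiveDimensionLT_X₁ (X := FPMod.of R (LinearMap.range f.hom.hom))
          (Y := Y.toFPMod) (Z := FPMod.of R (Y.obj ⧸ LinearMap.range f.hom.hom))
          (Submodule.subtype _) (Submodule.mkQ _) (LinearMap.exact_subtype_mkQ _)
          (Submodule.subtype_injective _) (Submodule.mkQ_surjective _) (by omega) (hg _)
      refine FPMod.hasProjectiveDimensionLT_X₁ (X := FPMod.of R (LinearMap.ker f.hom.hom))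
        (Y := X.toFPMod) (Submodule.subtype _) f.hom.hom.rangeRestrict ?_
        (Submodule.subtype_injective _) f.hom.hom.surjective_rangeRestrict hn hr
      rw [LinearMap.exact_iff, LinearMap.ker_rangeRestrict, Submodule.range_subtype]
    | succ k ih =>
      intro m h
      obtain ⟨C, hCf, hC, K, ι, hι, hex, hK⟩ := ih (m + 1) (by omega)
      obtain ⟨P, p, K', ι', hp, hι', hex', hK'⟩ := FPMod.exists_syzygy K m hK
      let g : P ⟶ C.left := FGProj.ofHom (ι ∘ₗ p)
      refine ⟨C.precomp g, hCf, fun i hi => ?_, K', ι', hι', ?_, hK'⟩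
      · cases i with
        | zero =>
          change Function.Exact (ι ∘ₗ p) (C.map' 0 1).hom.hom
          rw [LinearMap.exact_iff] at hex ⊢
          rw [hex, LinearMap.range_comp_of_range_eq_top _ (LinearMap.range_eq_top.2 hp)]
        | succ i => exact hC i (by omega)
      · change Function.Exact ι' (ι ∘ₗ p)
        rw [LinearMap.exact_iff] at hex' ⊢
        rw [← hex', LinearMap.ker_comp_of_ker_eq_bot _ (LinearMap.ker_eq_bot.2 hι)]
  obtain ⟨C, hCf, hC, K, ι, hι, hex, hK⟩ := key n 0 rfl
  refine ⟨C, hCf, (isHomFromExact_iff C).2 ⟨?_, hC⟩⟩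
  rw [injective_iff_map_eq_zero]
  intro x hx
  obtain ⟨y, rfl⟩ := (hex x).1 hx
  have h0 := (IsZero.iff_id_eq_zero K).1 (isZero_of_hasProjectiveDimensionLT_zero K)
  rw [show y = 0 from congrArg (fun b : K ⟶ K => b.hom.hom y) h0, map_zero]

end FGProj

/-! ### Ext of a transpose as homology of the original sequence -/

section ExtOfTranspose

open Abelian

variable {R S : Type u} [Ring R] [Ring S] {B : Type u} [AddCommGroup B] [Module R B] [Module S B]
  [SMulCommClass R S B]

/-- B is free of rank one over R, hence itself an admissible test object. -/
theorem HasCommonGenerator.exact_lcomp (hB : HasCommonGenerator R S B) {X Y Z : FGProj R}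
    (f : X ⟶ Y) (g : Y ⟶ Z)
    (h : ∀ W : FGProj R, Function.Exact (fun a : Z ⟶ W => g ≫ a) (fun a : Y ⟶ W => f ≫ a)) :
    Function.Exact (LinearMap.lcomp S B g.hom.hom) (LinearMap.lcomp S B f.hom.hom) := by
  obtain ⟨e⟩ := hB.exists_linearEquiv
  have := Module.Finite.equiv e
  have := Module.Projective.of_equiv e
  intro φ
  have hφ := h (FGProj.of R B) (FGProj.ofHom φ)
  constructor
  · intro h0
    obtain ⟨a, ha⟩ := hφ.1 (by ext x; exact LinearMap.congr_fun h0 x)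
    exact ⟨a.hom.hom, by ext x; exact congrArg (fun c => c.hom.hom x) ha⟩
  · rintro ⟨ψ, rfl⟩
    have h0 := hφ.2 ⟨FGProj.ofHom ψ, rfl⟩
    ext x
    exact congrArg (fun c : X ⟶ FGProj.of R B => c.hom.hom x) h0

variable [SMulCommClass S R B]

theorem HasCommonGenerator.finitePresentation_dual (hB : HasCommonGenerator R S B)
    (P : FGProj R) : Module.FinitePresentation S (P.obj →ₗ[R] B) :=
  have := (hB.dual_finite_projective P.obj).1
  have := (hB.dual_finite_projective P.obj).2
  Module.finitePresentation_of_projective _ _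

theorem HasCommonGenerator.comp_eq_zero (hB : HasCommonGenerator R S B) {P₀ P₁ P₂ : FGProj R}
    {a : P₀.obj →ₗ[R] P₁.obj} {b : P₁.obj →ₗ[R] P₂.obj}
    (hab : Function.Exact (LinearMap.lcomp S B b) (LinearMap.lcomp S B a)) (y : P₀.obj) :
    b (a y) = 0 := by
  refine (hB.doubleDualEval_bijective P₂.obj).1 ?_
  rw [map_zero]
  ext φ
  exact LinearMap.congr_fun (hab.apply_apply_eq_zero φ) y

variable [IsAbelianCategory (FPMod S)] [HasExt.{w} (FPMod S)]

/-- The image of `a*` is the syzygy of T, and by exactness it is also the cokernel of `b*`; so it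
replaces T one place further along. -/
theorem HasCommonGenerator.exists_subsingleton_ext_add_two_iff (hB : HasCommonGenerator R S B)
    {P₀ P₁ P₂ : FGProj R} (a : P₀.obj →ₗ[R] P₁.obj) (b : P₁.obj →ₗ[R] P₂.obj)
    (hab : Function.Exact (LinearMap.lcomp S B b) (LinearMap.lcomp S B a)) (T : FPMod S)
    (q : (P₀.obj →ₗ[R] B) →ₗ[S] T.obj) (hq : Function.Exact (LinearMap.lcomp S B a) q)
    (hq' : Function.Surjective q) :
    ∃ (T' : FPMod S) (q' : (P₁.obj →ₗ[R] B) →ₗ[S] T'.obj),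
      Function.Exact (LinearMap.lcomp S B b) q' ∧ Function.Surjective q' ∧
      ∀ (Y : FPMod S) (i : ℕ), Subsingleton (Ext T Y (i + 2)) ↔ Subsingleton (Ext T' Y (i + 1)) := by
  have := (hB.dual_finite_projective P₀.obj).2
  have := hB.finitePresentation_dual P₀
  have := hB.finitePresentation_dual P₁
  have := FPMod.hasFPKernels.range (LinearMap.lcomp S B a)
  let K := LinearMap.range (LinearMap.lcomp S B a)
  let D : FPMod S := FPMod.of S (P₀.obj →ₗ[R] B)
  have : Projective D := FPMod.projective_of_moduleProjective D
  have hK : Function.Exact K.subtype q := by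
    rw [LinearMap.exact_iff] at hq ⊢
    rw [hq, Submodule.range_subtype]
  refine ⟨FPMod.of S K, (LinearMap.lcomp S B a).rangeRestrict, ?_,
    LinearMap.surjective_rangeRestrict _, (FPMod.shortExact (X := FPMod.of S K) (Y := D) K.subtype q
      hK K.subtype_injective hq').subsingleton_ext_add_two_iff⟩
  rw [LinearMap.exact_iff] at hab ⊢
  rw [LinearMap.ker_rangeRestrict, hab]

variable [Module.FinitePresentation S B]

/-- Let K be the image of `a*`. As K is the cokernel of `b*`, biduality turns maps from K to B into
elements of ker b. Such a map extends to the dual of `P₀` iff its element lies in the image of `a`.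
-/
theorem HasCommonGenerator.subsingleton_ext_one_iff (hB : HasCommonGenerator R S B)
    {P₀ P₁ P₂ : FGProj R} (a : P₀.obj →ₗ[R] P₁.obj) (b : P₁.obj →ₗ[R] P₂.obj)
    (hab : Function.Exact (LinearMap.lcomp S B b) (LinearMap.lcomp S B a)) (T : FPMod S)
    (q : (P₀.obj →ₗ[R] B) →ₗ[S] T.obj) (hq : Function.Exact (LinearMap.lcomp S B a) q)
    (hq' : Function.Surjective q) :
    Subsingleton (Ext T (FPMod.of S B) 1) ↔ Function.Exact a b := by
  have := (hB.dual_finite_projective P₀.obj).2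
  have := hB.finitePresentation_dual P₀
  have := hB.finitePresentation_dual P₁
  have := FPMod.hasFPKernels.range (LinearMap.lcomp S B a)
  let K := LinearMap.range (LinearMap.lcomp S B a)
  let D : FPMod S := FPMod.of S (P₀.obj →ₗ[R] B)
  have : Projective D := FPMod.projective_of_moduleProjective D
  have hK : Function.Exact K.subtype q := by
    rw [LinearMap.exact_iff] at hq ⊢
    rw [hq, Submodule.range_subtype]
  rw [(FPMod.shortExact (X := FPMod.of S K) (Y := D) K.subtype q hK K.subtype_injective
    hq').subsingleton_ext_one_iff (FPMod.of S B)]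
  constructor
  · intro H x
    constructor
    · intro hx
      obtain ⟨l, hl⟩ := LinearMap.exists_comp_eq_of_ker_le (LinearMap.lcomp S B a).rangeRestrict
        (doubleDualEval R S B P₁.obj x) (LinearMap.surjective_rangeRestrict _) fun φ hφ => by
          obtain ⟨ψ, rfl⟩ := (hab φ).1 (congrArg Subtype.val hφ)
          exact (congrArg ψ hx).trans (map_zero ψ)
      obtain ⟨h', hh'⟩ := H (FPMod.ofHom l)
      obtain ⟨y, hy⟩ := (hB.doubleDualEval_bijective P₀.obj).2 h'.hom.hom
      refine ⟨y, (hB.doubleDualEval_bijective P₁.obj).1 ?_⟩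
      ext φ
      have h1 := congrArg (fun c : FPMod.of S K ⟶ FPMod.of S B => c.hom.hom
        ((LinearMap.lcomp S B a).rangeRestrict φ)) hh'
      have h2 := LinearMap.congr_fun hy (LinearMap.lcomp S B a φ)
      have h3 := LinearMap.congr_fun hl φ
      exact h2.trans (h1.trans h3)
    · rintro ⟨y, rfl⟩
      exact hB.comp_eq_zero hab y
  · intro H h
    obtain ⟨x, hx⟩ := (hB.doubleDualEval_bijective P₁.obj).2
      (h.hom.hom ∘ₗ (LinearMap.lcomp S B a).rangeRestrict)
    have hbx : b x = 0 := by
      refine (hB.doubleDualEval_bijective P₂.obj).1 ?_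
      rw [map_zero]
      ext φ
      have h1 := LinearMap.congr_fun hx (LinearMap.lcomp S B b φ)
      refine h1.trans ?_
      have h2 : (LinearMap.lcomp S B a).rangeRestrict (LinearMap.lcomp S B b φ) = 0 :=
        Subtype.ext (hab.apply_apply_eq_zero φ)
      rw [LinearMap.comp_apply, h2, map_zero]
      rfl
    obtain ⟨y, rfl⟩ := (H x).1 hbx
    refine ⟨FPMod.ofHom (X := D) (Y := FPMod.of S B) (doubleDualEval R S B P₀.obj y), ?_⟩
    ext k
    obtain ⟨_, φ, rfl⟩ := k
    exact LinearMap.congr_fun hx φ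

/-- The vanishing of `Ext^(i+1)(T, B)` for a transpose `T` is the exactness of the `i`-th segment
of a sequence whose dual resolves `T`. -/
theorem HasCommonGenerator.subsingleton_ext_iff (hB : HasCommonGenerator R S B) {n : ℕ}
    (C : ComposableArrows (FGProj R) (n + 1)) (hC : IsHomToExact C) (k j i : ℕ) (hi : i < n)
    (hij : j + k = i) (T : FPMod S) (q : ((C.obj' j).obj →ₗ[R] B) →ₗ[S] T.obj)
    (hq : Function.Exact (LinearMap.lcomp S B (C.map' j (j + 1)).hom.hom) q)
    (hq' : Function.Surjective q) :
    Subsingleton (Ext T (FPMod.of S B) (k + 1)) ↔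
      Function.Exact (C.map' i (i + 1)).hom.hom (C.map' (i + 1) (i + 2)).hom.hom := by
  induction k generalizing j T with
  | zero =>
    obtain rfl : j = i := hij
    exact hB.subsingleton_ext_one_iff _ _ (hB.exact_lcomp _ _ fun W => (hC W).2 j hi) T q hq hq'
  | succ k ih =>
    -- Dimension shifting raises `j` and lowers the Ext degree, so the place `i = j + k` stays
    -- fixed.
    obtain ⟨T', q', h1, h2, h3⟩ := hB.exists_subsingleton_ext_add_two_iff _ _
      (hB.exact_lcomp _ _ fun W => (hC W).2 j (by omega)) T q hq hq'
    rw [h3]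
    exact ih (j + 1) (by omega) T' q' h1 h2

end ExtOfTranspose

/-! ### Torsion freeness and the axiom on monomorphisms -/

section Conditions

variable (C : Type u) [Category.{v} C] [Preadditive C] (n : ℕ)

/-- Every monomorphism followed by an `n`-cokernel of it is an `n`-kernel of the last arrow. -/
def MonoNCokernelIsNKernel : Prop :=
  ∀ X : ComposableArrows C (n + 1), Mono (X.map' 0 1) → IsHomToExact X → IsHomFromExact X

/-- Every epimorphism preceded by an `n`-kernel of it is an `n`-cokernel of the first arrow. -/
def EpiNKernelIsNCokernel : Prop :=
  ∀ X : ComposableArrows C (n + 1), Epi (X.map' n (n + 1)) → IsHomFromExact X → IsHomToExact X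

end Conditions

section TorsionFree

open Abelian

variable {R S : Type u} [Ring R] [Ring S] {B : Type u} [AddCommGroup B] [Module R B] [Module S B]
  [SMulCommClass R S B] [SMulCommClass S R B] [Module.FinitePresentation S B]
  [IsAbelianCategory (FPMod R)] [IsAbelianCategory (FPMod S)] {n : ℕ}

/-- The presentation defining the transpose need not begin with a monomorphism, so the axiom is
applied after its first term is replaced by the image. This does not affect exactness at the inner
places. -/
theorem HasCommonGenerator.isTorsionFree (hB : HasCommonGenerator R S B) (hn : 0 < n)
    (hcok : ∀ {X Y : FGProj R} (f : X ⟶ Y), ∃ C : ComposableArrows (FGProj R) (n + 1),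
      IsNCokernel C f)
    (hmono : MonoNCokernelIsNKernel (FGProj R) n) (M : FPMod R) (hM : HasProjectiveDimensionLE M 1) :
    IsTorsionFree (S := S) B n M := by
  -- Positivity of n keeps the last arrow distinct from the first, which is going to be replaced.
  obtain ⟨m, rfl⟩ : ∃ m, n = m + 1 := ⟨n - 1, by omega⟩
  rintro T ⟨P, Q, f, p, q, hfp, hp, hfq, hq⟩ i hi hin
  let := HasExt.standard (FPMod S)
  obtain ⟨i, rfl⟩ : ∃ k, i = k + 1 := ⟨i - 1, by omega⟩
  obtain ⟨C, ⟨e⟩, hC⟩ := hcok (FGProj.ofHom f)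
  obtain ⟨α, β, hαβ⟩ := FGProj.exists_linearEquiv_of_arrow_iso e
  let c : (C.obj' 0).obj →ₗ[R] (C.obj' 1).obj := (C.map' 0 1).hom.hom
  change ∀ x, f (α x) = β (c x) at hαβ
  have hcp : Function.Exact c (p ∘ₗ (β : _ →ₗ[R] Q.obj)) := fun x => by
    refine (hfp (β x)).trans ⟨?_, ?_⟩
    · rintro ⟨y, hy⟩
      obtain ⟨z, rfl⟩ := α.surjective y
      exact ⟨z, β.injective ((hαβ z).symm.trans hy)⟩
    · rintro ⟨z, rfl⟩
      exact ⟨α z, hαβ z⟩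
  have hcq : Function.Exact (LinearMap.lcomp S B c)
      (q ∘ₗ LinearMap.lcomp S B (α.symm : P.obj →ₗ[R] _)) := fun φ => by
    refine (hfq (LinearMap.lcomp S B (α.symm : P.obj →ₗ[R] _) φ)).trans ⟨?_, ?_⟩
    · rintro ⟨ψ, hψ⟩
      refine ⟨ψ ∘ₗ (β : _ →ₗ[R] Q.obj), ?_⟩
      ext x
      have h1 : ψ (f (α x)) = φ (α.symm (α x)) := LinearMap.congr_fun hψ (α x)
      rwa [hαβ, α.symm_apply_apply] at h1
    · rintro ⟨ψ, rfl⟩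
      refine ⟨ψ ∘ₗ (β.symm : Q.obj →ₗ[R] _), ?_⟩
      ext x
      obtain ⟨x, rfl⟩ := α.surjective x
      change ψ (β.symm (f (α x))) = ψ (c (α.symm (α x)))
      rw [hαβ, β.symm_apply_apply, α.symm_apply_apply]
  refine (hB.subsingleton_ext_iff C hC i 0 i (by omega) (by omega) T _ hcq
    (hq.comp fun φ => ⟨φ ∘ₗ (α : _ →ₗ[R] P.obj), by
      ext x
      exact congrArg φ (α.apply_symm_apply x)⟩)).2 ?_
  have := FPMod.hasFPKernels.range c
  -- The image of `c` is a first syzygy of M, hence projective because pdim M ≤ 1.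
  have hK : HasProjectiveDimensionLT (FPMod.of R (LinearMap.range c)) 1 :=
    FPMod.hasProjectiveDimensionLT_X₁ (Y := (C.obj' 1).toFPMod) (LinearMap.range c).subtype
      (p ∘ₗ (β : _ →ₗ[R] Q.obj)) (by
        rw [LinearMap.exact_iff] at hcp ⊢
        rw [hcp, Submodule.range_subtype]) (Submodule.subtype_injective _) (hp.comp β.surjective)
      le_rfl hM
  have := projective_iff_hasProjectiveDimensionLT_one.2 hK
  have : Module.Projective R (LinearMap.range c) := FPMod.moduleProjective (FPMod.of R _)
  let ι : FGProj.of R (LinearMap.range c) ⟶ C.δ₀.left := FGProj.ofHom (LinearMap.range c).subtype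
  have hι : Mono ι := mono_of_injective ι (Submodule.subtype_injective _)
  -- As `c` maps onto its image, a map out of the second term kills `c` iff it kills `ι`.
  have hC' : IsHomToExact (C.δ₀.precomp ι) := by
    refine fun Z => ⟨(hC Z).1, fun i hi => ?_⟩
    cases i with
    | zero =>
      intro a
      refine Iff.trans ?_ ((hC Z).2 0 hi a)
      constructor
      · intro h
        ext x
        exact congrArg (fun b : FGProj.of R (LinearMap.range c) ⟶ Z => b.hom.hom ⟨c x, x, rfl⟩) h
      · intro h
        ext x
        obtain ⟨_, x, rfl⟩ := x
        exact congrArg (fun b : C.obj' 0 ⟶ Z => b.hom.hom x) h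
    | succ i => exact (hC Z).2 (i + 1) hi
  have hex := ((FGProj.isHomFromExact_iff _).1 (hmono _ hι hC')).2 i (by omega)
  cases i with
  | zero =>
    change Function.Exact (LinearMap.range c).subtype (C.map' 1 2).hom.hom at hex
    change Function.Exact c (C.map' 1 2).hom.hom
    rw [LinearMap.exact_iff] at hex ⊢
    rw [hex, Submodule.range_subtype]
  | succ i => exact hex

/-- An injective first arrow is a length-one resolution of its cokernel M, and the cokernel of its
dual is a transpose of M. -/
theorem HasCommonGenerator.monoNCokernelIsNKernel (hB : HasCommonGenerator R S B)
    (h : ∀ M : FPMod R, HasProjectiveDimensionLE M 1 → IsTorsionFree (S := S) B n M) :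
    MonoNCokernelIsNKernel (FGProj R) n := by
  intro C _ hC
  have hinj : Function.Injective (C.map' 0 1).hom.hom := FGProj.injective_of_mono _
  refine (FGProj.isHomFromExact_iff C).2 ⟨hinj, fun i hi => ?_⟩
  let X₀ : FGProj R := C.obj' 0
  let X₁ : FGProj R := C.obj' 1
  let c : X₀.obj →ₗ[R] X₁.obj := (C.map' 0 1).hom.hom
  have := Module.FinitePresentation.quotient_range c
  have : Module.FinitePresentation S (X₀.obj →ₗ[R] B) := hB.finitePresentation_dual _
  have : Module.FinitePresentation S (X₁.obj →ₗ[R] B) := hB.finitePresentation_dual _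
  have := Module.FinitePresentation.quotient_range (LinearMap.lcomp S B c)
  let M := FPMod.of R (X₁.obj ⧸ LinearMap.range c)
  let T := FPMod.of S ((X₀.obj →ₗ[R] B) ⧸ LinearMap.range (LinearMap.lcomp S B c))
  have h1 : HasProjectiveDimensionLT X₀.toFPMod 1 :=
    projective_iff_hasProjectiveDimensionLT_one.1 (FPMod.projective_of_moduleProjective _)
  have hM : HasProjectiveDimensionLE M 1 :=
    FPMod.hasProjectiveDimensionLT_X₃ (X := X₀.toFPMod) (Y := X₁.toFPMod) (Z := M)
      c (Submodule.mkQ _) (LinearMap.exact_map_mkQ_range c) hinj (Submodule.mkQ_surjective _) h1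
  let := HasExt.standard (FPMod S)
  have hq : Function.Exact (LinearMap.lcomp S B c) (LinearMap.range (LinearMap.lcomp S B c)).mkQ :=
    LinearMap.exact_map_mkQ_range _
  exact (hB.subsingleton_ext_iff C hC i 0 i hi (by omega) T _ hq (Submodule.mkQ_surjective _)).1
    (h M hM T ⟨X₀, X₁, c, Submodule.mkQ _, Submodule.mkQ _,
      LinearMap.exact_map_mkQ_range c, Submodule.mkQ_surjective _, hq,
      Submodule.mkQ_surjective _⟩ (i + 1) (by omega) (by omega))

end TorsionFree

/-! ### Reversing sequences along a contravariant equivalence -/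

section Reversal

variable {C D : Type u} [Category.{v} C] [Category.{v} D] (F : Cᵒᵖ ⥤ D)

/-- The image of a sequence of composable arrows under a contravariant functor, reversed. -/
def CategoryTheory.ComposableArrows.reverse {n : ℕ} (X : ComposableArrows C n) :
    ComposableArrows D n where
  obj i := F.obj (.op (X.obj i.rev))
  map f := F.map (X.map (homOfLE (Fin.rev_le_rev.2 (leOfHom f)))).op
  map_id i := by
    rw [← F.map_id]
    exact congrArg (fun a => F.map a.op) (X.map_id _)
  map_comp f g := by
    rw [← F.map_comp, ← op_comp, ← X.map_comp]
    rfl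

/-- The segment `i ⟶ i + 1` of the reversed sequence. -/
theorem reverse_map_iff {n : ℕ} (X : ComposableArrows C n) (p : ∀ {A B : D}, (A ⟶ B) → Prop)
    (i j : ℕ) (h : i + j + 1 = n) :
    p ((X.reverse F).map' i (i + 1)) ↔ p (F.map (X.map' j (j + 1)).op) := by
  -- Reversed indices agree with the expected ones only propositionally; generalizing the endpoints
  -- allows substitution.
  have key : ∀ (a b : Fin (n + 1)) (hab : a ≤ b) (a' b' : Fin (n + 1)) (hab' : a' ≤ b'),
      a = a' → b = b' → (p (F.map (X.map (homOfLE hab)).op) ↔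
        p (F.map (X.map (homOfLE hab')).op)) := by
    rintro a b hab _ _ _ rfl rfl
    rfl
  refine key _ _ _ _ _ _ ?_ ?_ <;> ext <;> simp <;> omega

theorem reverse_map_map_iff {n : ℕ} (X : ComposableArrows C n)
    (p : ∀ {A B E : D}, (A ⟶ B) → (B ⟶ E) → Prop) (i j : ℕ) (h : i + j + 2 = n) :
    p ((X.reverse F).map' i (i + 1)) ((X.reverse F).map' (i + 1) (i + 2)) ↔
      p (F.map (X.map' (j + 1) (j + 2)).op) (F.map (X.map' j (j + 1)).op) := by
  have key : ∀ (a b c : Fin (n + 1)) (hab : a ≤ b) (hbc : b ≤ c) (a' b' c' : Fin (n + 1))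
      (hab' : a' ≤ b') (hbc' : b' ≤ c'), a = a' → b = b' → c = c' →
      (p (F.map (X.map (homOfLE hbc)).op) (F.map (X.map (homOfLE hab)).op) ↔
        p (F.map (X.map (homOfLE hbc')).op) (F.map (X.map (homOfLE hab')).op)) := by
    rintro a b c hab hbc _ _ _ _ _ rfl rfl rfl
    rfl
  refine key _ _ _ _ _ _ _ _ _ _ ?_ ?_ ?_ <;> ext <;> simp <;> omega

theorem nonempty_arrow_iso_map_op {X Y X' Y' : C} {f : X ⟶ Y} {g : X' ⟶ Y'}
    (e : Arrow.mk f ≅ Arrow.mk g) : Nonempty (Arrow.mk (F.map f.op) ≅ Arrow.mk (F.map g.op)) := by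
  refine ⟨Arrow.isoMk (F.mapIso (Arrow.rightFunc.mapIso e).symm.op)
    (F.mapIso (Arrow.leftFunc.mapIso e).symm.op) ?_⟩
  have h : e.inv.left ≫ f = g ≫ e.inv.right := e.inv.w
  change F.map e.inv.right.op ≫ F.map g.op = F.map f.op ≫ F.map e.inv.left.op
  rw [← F.map_comp, ← F.map_comp, ← op_comp, ← op_comp, h]

variable [F.IsEquivalence]

theorem mono_map_op_iff {X Y : C} (f : X ⟶ Y) : Mono (F.map f.op) ↔ Epi f := by
  rw [F.mono_map_iff_mono]
  exact ⟨fun _ => unop_epi_of_mono f.op, fun _ => inferInstance⟩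

theorem epi_map_op_iff {X Y : C} (f : X ⟶ Y) : Epi (F.map f.op) ↔ Mono f := by
  rw [F.epi_map_iff_epi]
  exact ⟨fun _ => unop_mono_of_epi f.op, fun _ => inferInstance⟩

theorem exists_arrow_iso_map_op {X Y : D} (f : X ⟶ Y) :
    ∃ (X' Y' : C) (f' : X' ⟶ Y'), Nonempty (Arrow.mk (F.map f'.op) ≅ Arrow.mk f) :=
  ⟨_, _, (F.preimage ((F.objObjPreimageIso X).hom ≫ f ≫ (F.objObjPreimageIso Y).inv)).unop,
    ⟨Arrow.isoMk (F.objObjPreimageIso X) (F.objObjPreimageIso Y) (by simp)⟩⟩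

variable [Preadditive C] [Preadditive D]

/-- Exactness of `C(-, X) ⟶ C(-, Y) ⟶ C(-, Z)`. -/
def HomFromExactAt {X Y Z : C} (f : X ⟶ Y) (g : Y ⟶ Z) : Prop :=
  ∀ W : C, Function.Exact (fun a : W ⟶ X => a ≫ f) (fun a : W ⟶ Y => a ≫ g)

/-- Exactness of `C(Z, -) ⟶ C(Y, -) ⟶ C(X, -)`. -/
def HomToExactAt {X Y Z : C} (f : X ⟶ Y) (g : Y ⟶ Z) : Prop :=
  ∀ W : C, Function.Exact (fun a : Z ⟶ W => g ≫ a) (fun a : Y ⟶ W => f ≫ a)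

theorem isHomFromExact_iff_mono {n : ℕ} (X : ComposableArrows C (n + 1)) :
    IsHomFromExact X ↔ Mono (X.map' 0 1) ∧
      ∀ (i : ℕ) (hi : i < n), HomFromExactAt (X.map' i (i + 1)) (X.map' (i + 1) (i + 2)) :=
  ⟨fun h => ⟨⟨fun _ _ hab => (h _).1 hab⟩, fun i hi W => (h W).2 i hi⟩,
    fun ⟨_, h⟩ W => ⟨fun _ _ hab => (cancel_mono _).1 hab, fun i hi => h i hi W⟩⟩

theorem isHomToExact_iff_epi {n : ℕ} (X : ComposableArrows C (n + 1)) :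
    IsHomToExact X ↔ Epi (X.map' n (n + 1)) ∧
      ∀ (i : ℕ) (hi : i < n), HomToExactAt (X.map' i (i + 1)) (X.map' (i + 1) (i + 2)) :=
  ⟨fun h => ⟨⟨fun _ _ hab => (h _).1 hab⟩, fun i hi W => (h W).2 i hi⟩,
    fun ⟨_, h⟩ W => ⟨fun _ _ hab => (cancel_epi _).1 hab, fun i hi => h i hi W⟩⟩

theorem Function.Exact.iff_of_equiv {A₁ A₂ A₃ B₁ B₂ B₃ : Type*} [Zero A₃] [Zero B₃]
    {f : A₁ → A₂} {g : A₂ → A₃} {f' : B₁ → B₂} {g' : B₂ → B₃} (e₁ : A₁ ≃ B₁) (e₂ : A₂ ≃ B₂)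
    (e₃ : A₃ ≃ B₃) (h0 : e₃ 0 = 0) (hf : ∀ x, f' (e₁ x) = e₂ (f x))
    (hg : ∀ x, g' (e₂ x) = e₃ (g x)) : Function.Exact f g ↔ Function.Exact f' g' := by
  have h1 : ∀ x, g' (e₂ x) = 0 ↔ g x = 0 := fun x => by
    rw [hg, ← h0, e₃.apply_eq_iff_eq]
  have h2 : ∀ x, e₂ x ∈ Set.range f' ↔ x ∈ Set.range f := fun x => by
    simp only [Set.mem_range]
    rw [← e₁.exists_congr_right (q := fun y => f' y = e₂ x)]
    simp only [hf, e₂.apply_eq_iff_eq]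
  unfold Function.Exact
  rw [← e₂.forall_congr_right (q := fun y => g' y = 0 ↔ y ∈ Set.range f')]
  simp only [h1, h2]

theorem homFromExactAt_map_iff {X Y Z : C} (f : X ⟶ Y) (g : Y ⟶ Z) :
    HomFromExactAt (F.map g.op) (F.map f.op) ↔ HomToExactAt f g := by
  -- By essential surjectivity every test object V is isomorphic to the image of some W, and full
  -- faithfulness identifies the Hom sets.
  have key : ∀ (V : D) (W : C) (u : F.obj (.op W) ≅ V),
      Function.Exact (fun a : Z ⟶ W => g ≫ a) (fun a : Y ⟶ W => f ≫ a) ↔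
      Function.Exact (fun a : V ⟶ F.obj (.op Z) => a ≫ F.map g.op)
        (fun a : V ⟶ F.obj (.op Y) => a ≫ F.map f.op) := fun V W u => by
    let e (A : C) : (A ⟶ W) ≃ (V ⟶ F.obj (.op A)) :=
      ((opEquiv (.op W) (.op A)).symm.trans
        (Functor.FullyFaithful.ofFullyFaithful F).homEquiv).trans u.homFromEquiv
    refine Function.Exact.iff_of_equiv (e Z) (e Y) (e X) ?_ ?_ ?_ <;> intros <;>
      simp [e, Functor.FullyFaithful.homEquiv, opEquiv]
  constructor
  · exact fun h W => (key _ W (Iso.refl _)).2 (h _)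
  · exact fun h V => (key V (F.objPreimage V).unop (F.objObjPreimageIso V)).1 (h _)

theorem homToExactAt_map_iff {X Y Z : C} (f : X ⟶ Y) (g : Y ⟶ Z) :
    HomToExactAt (F.map g.op) (F.map f.op) ↔ HomFromExactAt f g := by
  have key : ∀ (V : D) (W : C) (u : F.obj (.op W) ≅ V),
      Function.Exact (fun a : W ⟶ X => a ≫ f) (fun a : W ⟶ Y => a ≫ g) ↔
      Function.Exact (fun a : F.obj (.op X) ⟶ V => F.map f.op ≫ a)
        (fun a : F.obj (.op Y) ⟶ V => F.map g.op ≫ a) := fun V W u => by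
    let e (A : C) : (W ⟶ A) ≃ (F.obj (.op A) ⟶ V) :=
      ((opEquiv (.op A) (.op W)).symm.trans
        (Functor.FullyFaithful.ofFullyFaithful F).homEquiv).trans u.homToEquiv
    refine Function.Exact.iff_of_equiv (e X) (e Y) (e Z) ?_ ?_ ?_ <;> intros <;>
      simp [e, Functor.FullyFaithful.homEquiv, opEquiv]
  constructor
  · exact fun h W => (key _ W (Iso.refl _)).2 (h _)
  · exact fun h V => (key V (F.objPreimage V).unop (F.objObjPreimageIso V)).1 (h _)

theorem isHomFromExact_reverse_iff {n : ℕ} (X : ComposableArrows C (n + 1)) :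
    IsHomFromExact (X.reverse F) ↔ IsHomToExact X := by
  rw [isHomFromExact_iff_mono, isHomToExact_iff_epi]
  refine and_congr ((reverse_map_iff F X (fun f => Mono f) 0 n (by omega)).trans
    (mono_map_op_iff F _)) ⟨fun h i hi => ?_, fun h i hi => ?_⟩
  · exact (homFromExactAt_map_iff F _ _).1 ((reverse_map_map_iff F X (fun f g => HomFromExactAt f g)
      (n - 1 - i) i (by omega)).1 (h (n - 1 - i) (by omega)))
  · exact (reverse_map_map_iff F X (fun f g => HomFromExactAt f g) i (n - 1 - i) (by omega)).2
      ((homFromExactAt_map_iff F _ _).2 (h (n - 1 - i) (by omega)))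

theorem isHomToExact_reverse_iff {n : ℕ} (X : ComposableArrows C (n + 1)) :
    IsHomToExact (X.reverse F) ↔ IsHomFromExact X := by
  rw [isHomFromExact_iff_mono, isHomToExact_iff_epi]
  refine and_congr ((reverse_map_iff F X (fun f => Epi f) n 0 (by omega)).trans
    (epi_map_op_iff F _)) ⟨fun h i hi => ?_, fun h i hi => ?_⟩
  · exact (homToExactAt_map_iff F _ _).1 ((reverse_map_map_iff F X (fun f g => HomToExactAt f g)
      (n - 1 - i) i (by omega)).1 (h (n - 1 - i) (by omega)))
  · exact (reverse_map_map_iff F X (fun f g => HomToExactAt f g) i (n - 1 - i) (by omega)).2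
      ((homToExactAt_map_iff F _ _).2 (h (n - 1 - i) (by omega)))

theorem exists_nCokernel_of_exists_nKernel (F : Cᵒᵖ ⥤ D) [F.IsEquivalence] {n : ℕ}
    (h : ∀ {X Y : C} (f : X ⟶ Y), ∃ S : ComposableArrows C (n + 1), IsNKernel S f)
    {X Y : D} (f : X ⟶ Y) : ∃ S : ComposableArrows D (n + 1), IsNCokernel S f := by
  obtain ⟨X', Y', f', ⟨e⟩⟩ := exists_arrow_iso_map_op F f
  obtain ⟨S, ⟨e'⟩, hS⟩ := h f'
  obtain ⟨e''⟩ := nonempty_arrow_iso_map_op F e'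
  exact ⟨S.reverse F, (reverse_map_iff F S (fun g => Nonempty (Arrow.mk g ≅ Arrow.mk f)) 0 n
    (by omega)).2 ⟨e'' ≪≫ e⟩, (isHomToExact_reverse_iff F S).2 hS⟩

theorem exists_nKernel_of_exists_nCokernel (F : Cᵒᵖ ⥤ D) [F.IsEquivalence] {n : ℕ}
    (h : ∀ {X Y : C} (f : X ⟶ Y), ∃ S : ComposableArrows C (n + 1), IsNCokernel S f)
    {X Y : D} (f : X ⟶ Y) : ∃ S : ComposableArrows D (n + 1), IsNKernel S f := by
  obtain ⟨X', Y', f', ⟨e⟩⟩ := exists_arrow_iso_map_op F f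
  obtain ⟨S, ⟨e'⟩, hS⟩ := h f'
  obtain ⟨e''⟩ := nonempty_arrow_iso_map_op F e'
  exact ⟨S.reverse F, (reverse_map_iff F S (fun g => Nonempty (Arrow.mk g ≅ Arrow.mk f)) n 0
    (by omega)).2 ⟨e'' ≪≫ e⟩, (isHomFromExact_reverse_iff F S).2 hS⟩

theorem MonoNCokernelIsNKernel.epiNKernelIsNCokernel (F : Cᵒᵖ ⥤ D) [F.IsEquivalence] {n : ℕ}
    (h : MonoNCokernelIsNKernel D n) :
    EpiNKernelIsNCokernel C n := fun X hX hX' =>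
  (isHomFromExact_reverse_iff F X).1 (h _ ((reverse_map_iff F X (fun f => Mono f) 0 n
    (by omega)).2 ((mono_map_op_iff F _).2 hX)) ((isHomToExact_reverse_iff F X).2 hX'))

theorem EpiNKernelIsNCokernel.monoNCokernelIsNKernel (F : Cᵒᵖ ⥤ D) [F.IsEquivalence] {n : ℕ}
    (h : EpiNKernelIsNCokernel D n) :
    MonoNCokernelIsNKernel C n := fun X hX hX' =>
  (isHomToExact_reverse_iff F X).1 (h _ ((reverse_map_iff F X (fun f => Epi f) n 0
    (by omega)).2 ((epi_map_op_iff F _).2 hX)) ((isHomFromExact_reverse_iff F X).2 hX'))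

end Reversal

/-! ### Assembling the equivalence -/

section NAbelian

variable {C : Type u} [Category.{v} C]

theorem mono_of_arrow_iso {X Y X' Y' : C} {f : X ⟶ Y} {g : X' ⟶ Y'}
    (e : Arrow.mk f ≅ Arrow.mk g) [hg : Mono g] : Mono f :=
  ((MorphismProperty.monomorphisms C).arrow_mk_iso_iff e).2 hg

theorem epi_of_arrow_iso {X Y X' Y' : C} {f : X ⟶ Y} {g : X' ⟶ Y'}
    (e : Arrow.mk f ≅ Arrow.mk g) [hg : Epi g] : Epi f :=
  ((MorphismProperty.epimorphisms C).arrow_mk_iso_iff e).2 hg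

variable [Preadditive C] {n : ℕ}

theorem IsNAbelian.monoNCokernelIsNKernel (h : IsNAbelian C n) : MonoNCokernelIsNKernel C n :=
  fun X hX hX' => (h.isNKernel_of_mono _ hX X ⟨⟨Iso.refl _⟩, hX'⟩).2

theorem IsNAbelian.epiNKernelIsNCokernel (h : IsNAbelian C n) : EpiNKernelIsNCokernel C n :=
  fun X hX hX' => (h.isNCokernel_of_epi _ hX X ⟨⟨Iso.refl _⟩, hX'⟩).2

end NAbelian

section Main

variable {R S : Type u} [Ring R] [Ring S] {B : Type u} [AddCommGroup B] [Module R B] [Module S B]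
  [SMulCommClass R S B] [SMulCommClass S R B] [Module.FinitePresentation R B]
  [Module.FinitePresentation S B]

/-- The dualities in both directions exchange cokernel and epimorphism axioms over R with kernel and
monomorphism axioms over S, so only the latter kind is ever compared with modules. -/
theorem HasCommonGenerator.isNAbelian_iff (hB : HasCommonGenerator R S B) {n : ℕ} (hn : 0 < n) :
    IsNAbelian (FGProj R) n ↔
      ∃ (_ : IsAbelianCategory (FPMod R)) (_ : IsAbelianCategory (FPMod S)),
        GlobalDimensionLE (FPMod R) (n + 1) ∧ GlobalDimensionLE (FPMod S) (n + 1) ∧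
        (∀ M : FPMod R, HasProjectiveDimensionLE M 1 → IsTorsionFree (S := S) B n M) ∧
        (∀ M : FPMod S, HasProjectiveDimensionLE M 1 → IsTorsionFree (S := R) B n M) := by
  have := hB.dual_isEquivalence
  have := hB.symm.dual_isEquivalence
  constructor
  · intro h
    have hk {X Y : FGProj S} (f : X ⟶ Y) :=
      exists_nKernel_of_exists_nCokernel hB.dual h.exists_nCokernel f
    have hc {X Y : FGProj S} (f : X ⟶ Y) :=
      exists_nCokernel_of_exists_nKernel hB.dual h.exists_nKernel f
    have hR := (FGProj.hasFPKernels_of_exists_nKernel hn h.exists_nKernel).isAbelianCategory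
    have hS := (FGProj.hasFPKernels_of_exists_nKernel hn hk).isAbelianCategory
    exact ⟨hR, hS, FGProj.globalDimensionLE_of_exists_nKernel h.exists_nKernel,
      FGProj.globalDimensionLE_of_exists_nKernel hk,
      hB.isTorsionFree hn h.exists_nCokernel h.monoNCokernelIsNKernel,
      hB.symm.isTorsionFree hn hc
        (h.epiNKernelIsNCokernel.monoNCokernelIsNKernel hB.symm.dual)⟩
  · rintro ⟨hR, hS, dR, dS, tR, tS⟩
    have hmono := hB.monoNCokernelIsNKernel tR
    have hepi := (hB.symm.monoNCokernelIsNKernel tS).epiNKernelIsNCokernel hB.dual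
    exact
      { hasZeroObject := FGProj.hasZeroObject R
        hasFiniteBiproducts := FGProj.hasFiniteBiproducts R
        isIdempotentComplete := FGProj.isIdempotentComplete R
        exists_nKernel := FGProj.exists_nKernel hn dR
        exists_nCokernel := exists_nCokernel_of_exists_nKernel hB.symm.dual
          (FGProj.exists_nKernel hn dS)
        isNKernel_of_mono := fun f _ X ⟨⟨e⟩, hX⟩ =>
          ⟨⟨Iso.refl _⟩, hmono X (mono_of_arrow_iso e) hX⟩
        isNCokernel_of_epi := fun f _ X ⟨⟨e⟩, hX⟩ =>
          ⟨⟨Iso.refl _⟩, hepi X (epi_of_arrow_iso e) hX⟩ }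

end Main

/-- The common generator is the identity element. -/
theorem hasCommonGenerator_self (Λ : Type u) [Ring Λ] : HasCommonGenerator Λᵐᵒᵖ Λ Λ :=
  ⟨1, by simpa using MulOpposite.unop_bijective, by simpa using! Function.bijective_id⟩

theorem theorem4 (Λ : Type u) [Ring Λ] (n : ℕ) (hn : 0 < n) :
    IsNAbelian (FGProj Λᵐᵒᵖ) n ↔
      ∃ (_ : IsRightCoherent Λ) (_ : IsLeftCoherent Λ),
        GlobalDimensionLE (FPMod Λᵐᵒᵖ) (n + 1) ∧
        GlobalDimensionLE (FPMod Λ) (n + 1) ∧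
        (∀ M : FPMod Λᵐᵒᵖ, HasProjectiveDimensionLE M 1 → IsRightTorsionFree n M) ∧
        (∀ M : FPMod Λ, HasProjectiveDimensionLE M 1 → IsLeftTorsionFree n M) :=
  (hasCommonGenerator_self Λ).isNAbelian_iff hn
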